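/- **Notation.** For $x\in\mathbb R^n$ and $R>0$ let $Q_R(x)=\{y\in\mathbb R^n:\ \max_{1\le i\le n}|y_i-x_i|<R\}$; $\|\cdot\|_{q,A}$ is the norm of $L^q(A)$ (Lebesgue measure), and $\Phi\in L^q_{\rm loc}(U)$ means $\Phi\in L^q(K)$ for every compact $K\subset U$. **Corollary.** Let $n\ge 2$, let $\Omega\subset\mathbb R^n$ be a bounded open set, and let $x_0\in\Omega$ and $R_0>0$ be such that $\sqrt n\,R_0<\operatorname{dist}(x_0,\partial\Omega)$. Let $p>1$, $\delta>0$, $0<t<p$, $\alpha\in[1/2,1)$ and $B>0$, and let the nonnegative functions $\Phi\in L^p(\Omega)$ and $\Psi\in L^{p+\delta}(\Omega)$ satisfy $$\frac1{R^n}\int_{Q_{\alpha R}(z)}\Phi^p\,dx\ \le\ B\Big(\frac1{R^n}\int_{Q_R(z)}\Phi^t\,dx\Big)^{p/t}+\frac1{R^n}\int_{Q_R(z)}\Psi^p\,dx$$ for all $z\in Q_{R_0}(x_0)$ and all $R>0$ with $\sqrt n\,R<\operatorname{dist}(z,\partial Q_{R_0}(x_0))$. Let $s\ge p/t$ (for instance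 $s=p/t$, or $s=p$ if $t\ge1$) and put $$\varkappa=(8^n+1)\,2^{3ns}\,\big(B^{1/s}+1\big)^s .$$ Then for every $q\in[p,p+\delta]\cap\big[p,\,p+\tfrac{p-t}{\varkappa-1}\big)$ we have $\Phi\in L^q_{\rm loc}(Q_{R_0}(x_0))$, and for every $0<r<R_0$ $$\|\Phi\|_{q,Q_{r/2}(x_0)}^q\le\frac{2^{nq/p}}{q-t-\varkappa(q-p)}\Big[(p-t)\,r^{-n(q-p)/p}\,2^{(q-p)/p}\,\|\Phi\|_{p,Q_r(x_0)}^q+\Big(2^{(n+1)(q-p)/p}(p-t)+\varkappa(q-t)\Big)\|\Psi\|_{q,Q_r(x_0)}^q\Big].$$ -/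

import Mathlib

open MeasureTheory

namespace ReverseHolder

/-- The open cubic interval of centre `x` and radius `R` (so of side `2 * R`), with faces parallel
to the coordinate planes. -/
def cube {n : ℕ} (x : EuclideanSpace ℝ (Fin n)) (R : ℝ) : Set (EuclideanSpace ℝ (Fin n)) :=
  {y | ∀ i, |y i - x i| < R}

/-- The constant `(8 ^ n + 1) * 2 ^ (3 * n * s) * (B ^ (1 / s) + 1) ^ s`. -/
noncomputable def kappa (n : ℕ) (s B : ℝ) : ℝ :=
  ((8 : ℝ) ^ n + 1) * (2 : ℝ) ^ (3 * (n : ℝ) * s) * (B ^ (1 / s) + 1) ^ s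

/-- `f ∈ L^q_loc(U)`: `f` is in `L^q` of every compact subset of `U`. -/
def MemLpLocOn {n : ℕ} (f : EuclideanSpace ℝ (Fin n) → ℝ) (q : ℝ)
    (U : Set (EuclideanSpace ℝ (Fin n))) : Prop :=
  ∀ K : Set (EuclideanSpace ℝ (Fin n)), IsCompact K → K ⊆ U →
    MemLp f (ENNReal.ofReal q) (volume.restrict K)

end ReverseHolder

/-! This is Gehring's lemma with explicit constants. Cubes are balls of the sup norm, so the work is
done on `Fin n → ℝ`, in the ball of radius `r`. Multiplying `Φ` and `Ψ` by the power `n / p` of the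
normalised distance to the boundary gives `f` and `g`. The heart is the level-set inequality `∫_{f >
l} f^p ≤ k (l^(p-t) ∫_{f > l} f^t + ∫_{g > l} g^p)` for all `l` above a threshold `a`
(`lintegral_superlevel_le`).

Where `l < f ≤ K l` it holds pointwise. At almost every point with `f > K l`, averages of `φ^p` are
large at small scales, by Lebesgue differentiation, but small at the top admissible scale, because
`l` is large. A nearly maximal radius with large average gives a ball where the reverse Hölder
inequality bites while the tripled ball still has a controlled average
(`exists_ball_setIntegral_le`). `K` is so large that values below the level cannot produce the
average, so the superlevel sets must (`rpow_le_of_unit_reverse_holder`). The weight varies by at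
most a factor 2 on these balls, and Vitali's covering lemma sums the local estimates.

Integrating against `l^(q-p-1)` turns both `f` terms into `∫ f^q`, with coefficients in the ratio `q
- t` to `k (q - p)`; for `k (q - p) < q - t` the right one is absorbed. Truncation keeps it finite
meanwhile, and Fatou removes the truncation (`integral_rpow_le_of_level`).

The argument yields `k = κ / 2`; the spare half pays for the dimensional factor in the threshold `a`
(`rpow_mul_le_sub`). On the half cube the weight is at least `1 / 2`, whence the factor `2^(nq/p)`.
-/

namespace ReverseHolder

/-! ### Covering and differentiation -/

/-- A Vitali covering argument: a measure dominated on enlarged balls around each point of `S` by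
another measure on the balls themselves is dominated on `S`. -/
theorem measure_le_of_forall_exists_ball {n : ℕ} (μ ν : Measure (Fin n → ℝ))
    (S : Set (Fin n → ℝ)) (R : ℝ)
    (h : ∀ x ∈ S, ∃ ρ : ℝ, 0 < ρ ∧ ρ ≤ R ∧
      μ (Metric.ball x (3 * ρ)) ≤ ν (Metric.ball x ρ)) :
    μ S ≤ ν Set.univ := by
  choose! ρ hρ0 hρR hρ using h
  have hne : ∀ a ∈ S, (Metric.ball a (ρ a)).Nonempty := fun a ha =>
    Metric.nonempty_ball.2 (hρ0 a ha)
  obtain ⟨u, huS, hdisj, hcov⟩ := Vitali.exists_disjoint_subfamily_covering_enlargement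
    (fun a => Metric.ball a (ρ a)) S ρ 2 one_lt_two (fun a ha => (hρ0 a ha).le) R hρR hne
  have hu : u.Countable := hdisj.countable_of_isOpen (fun i _ => Metric.isOpen_ball)
    (fun i hi => hne i (huS hi))
  -- Only the centres have to be covered: a centre `a` whose ball meets the ball of `b` is within `ρ
  -- a + ρ b ≤ 3 * ρ b` of `b`. Hence the enlargement 3 instead of the usual 5.
  have hsub : S ⊆ ⋃ b ∈ u, Metric.ball b (3 * ρ b) := by
    intro a ha
    obtain ⟨b, hb, ⟨y, hya, hyb⟩, hab⟩ := hcov a ha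
    refine Set.mem_biUnion hb ?_
    rw [Metric.mem_ball] at *
    have := dist_triangle a y b
    rw [dist_comm a y] at this
    linarith
  calc μ S ≤ μ (⋃ b ∈ u, Metric.ball b (3 * ρ b)) := measure_mono hsub
    _ ≤ ∑' b : u, μ (Metric.ball (b : Fin n → ℝ) (3 * ρ b)) := measure_biUnion_le μ hu _
    _ ≤ ∑' b : u, ν (Metric.ball (b : Fin n → ℝ) (ρ b)) :=
        ENNReal.tsum_le_tsum fun b => hρ b (huS b.2)
    _ = ν (⋃ b ∈ u, Metric.ball b (ρ b)) :=
        (measure_biUnion hu hdisj fun b _ => measurableSet_ball).symm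
    _ ≤ ν Set.univ := measure_mono (Set.subset_univ _)

/-- Almost every point of `{x | c < f x}` is the centre of arbitrarily small balls on which the
average of `f` is larger than `c`. -/
theorem ae_exists_ball_integral_gt {n : ℕ} (hn : 1 ≤ n) {f : (Fin n → ℝ) → ℝ}
    (hf : LocallyIntegrable f) :
    ∀ᵐ x, ∀ c < f x, ∀ R₁ : ℝ, 0 < R₁ →
      ∃ R : ℝ, 0 < R ∧ R ≤ R₁ ∧ c * (2 * R) ^ n < ∫ y in Metric.ball x R, f y := by
  have : Nonempty (Fin n) := ⟨⟨0, hn⟩⟩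
  filter_upwards [IsUnifLocDoublingMeasure.ae_tendsto_average volume hf 1] with x hx c hc R₁ hR₁
  have h1 := hx (l := nhdsWithin (0 : ℝ) (Set.Ioi 0)) (fun _ => x) id Filter.tendsto_id (by
    filter_upwards [self_mem_nhdsWithin] with j hj
    simpa using (le_of_lt hj))
  have h2 := h1.eventually (lt_mem_nhds hc)
  have h3 : ∀ᶠ R : ℝ in nhdsWithin (0 : ℝ) (Set.Ioi 0), R ∈ Set.Ioc 0 R₁ :=
    Ioc_mem_nhdsGT hR₁
  obtain ⟨R, hR, hR0, hRR⟩ := (h2.and h3).exists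
  refine ⟨R, hR0, hRR, ?_⟩
  have hae : (Metric.closedBall x R : Set (Fin n → ℝ)) =ᵐ[volume] Metric.ball x R := by
    refine (ae_eq_of_subset_of_measure_ge Metric.ball_subset_closedBall ?_
      measurableSet_ball.nullMeasurableSet measure_closedBall_lt_top.ne).symm
    exact (Measure.addHaar_closedBall_eq_addHaar_ball volume x R).le
  rw [setAverage_eq, id, setIntegral_congr_set hae, smul_eq_mul] at hR
  have hvol : volume.real (Metric.closedBall x R) = (2 * R) ^ n := by
    rw [Measure.real, Real.volume_pi_closedBall x hR0.le, ENNReal.toReal_ofReal (by positivity)]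
    simp
  rw [hvol, inv_mul_eq_div, lt_div_iff₀ (by positivity)] at hR
  exact hR

/-! ### Arithmetic of the reverse Hölder inequality on one ball -/

/-- Here `a` and `b` are the contributions of the superlevel sets, and the terms `2 ^ n` bound those
of the values below level 1. Taking the power `t / p ≤ 1`, which is subadditive, makes the
inequality linear in `a`. The choice of `K` makes the constant terms at most a quarter of `K ^ t`,
so either `b` carries half of it or `a` carries a quarter. -/
theorem rpow_le_of_unit_reverse_holder {n : ℕ} (hn : 2 ≤ n) {p t B K a b : ℝ} (ht : 0 < t)
    (htp : t < p) (hB : 0 < B) (hK : 0 < K) (hKt : K ^ t = 8 ^ n * (B ^ (t / p) + 1))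
    (ha : 0 ≤ a) (hb : 0 ≤ b)
    (h : (1 / 2) ^ n * K ^ p ≤ B * (2 ^ n + a) ^ (p / t) + (2 ^ n + b)) :
    K ^ p ≤ 4 * 2 ^ n * B ^ (t / p) * K ^ (p - t) * a + 2 ^ n * (2 : ℝ) ^ (p / t) * b := by
  have hp : 0 < p := ht.trans htp
  set u := t / p with hu
  have hu0 : 0 < u := by positivity
  have hu1 : u ≤ 1 := (div_le_one hp).2 htp.le
  have hup : p * u = t := by rw [hu]; field_simp
  have htu : p / t * u = 1 := by rw [hu]; field_simp
  have hBu : 0 < B ^ u := by positivity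
  have h2n : (1 : ℝ) ≤ 2 ^ n := one_le_pow₀ one_le_two
  have h4 : (4 : ℝ) ^ n = 2 ^ n * 2 ^ n := by rw [← mul_pow]; norm_num
  have h8 : (8 : ℝ) ^ n = 2 ^ n * 4 ^ n := by rw [← mul_pow]; norm_num
  have h2n4 : (4 : ℝ) ≤ 2 ^ n := by
    calc (4 : ℝ) = 2 ^ 2 := by norm_num
      _ ≤ 2 ^ n := pow_le_pow_right₀ one_le_two hn
  have hT : K ^ p ≤ 2 ^ n * B * (2 ^ n + a) ^ (p / t) + 4 ^ n + 2 ^ n * b := by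
    have := mul_le_mul_of_nonneg_left h (by positivity : (0 : ℝ) ≤ 2 ^ n)
    rw [← mul_assoc, ← mul_pow] at this
    norm_num at this
    rw [h4]; linarith
  have hTu : K ^ t ≤ 2 ^ n * B ^ u * (2 ^ n + a) + 4 ^ n + (2 ^ n * b) ^ u := by
    calc K ^ t = (K ^ p) ^ u := by rw [← Real.rpow_mul hK.le, hup]
      _ ≤ (2 ^ n * B * (2 ^ n + a) ^ (p / t) + 4 ^ n + 2 ^ n * b) ^ u :=
        Real.rpow_le_rpow (by positivity) hT hu0.le
      _ ≤ (2 ^ n * B * (2 ^ n + a) ^ (p / t) + 4 ^ n) ^ u + (2 ^ n * b) ^ u :=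
        Real.rpow_add_le_add_rpow (by positivity) (by positivity) hu0.le hu1
      _ ≤ (2 ^ n * B * (2 ^ n + a) ^ (p / t)) ^ u + (4 ^ n) ^ u + (2 ^ n * b) ^ u := by
        gcongr
        exact Real.rpow_add_le_add_rpow (by positivity) (by positivity) hu0.le hu1
      _ ≤ _ := by
        rw [Real.mul_rpow (by positivity) (by positivity),
          Real.mul_rpow (by positivity) (by positivity),
          ← Real.rpow_mul (by positivity) (p / t) u, htu, Real.rpow_one]
        gcongr
        · exact Real.rpow_le_self_of_one_le h2n hu1
        · exact Real.rpow_le_self_of_one_le (one_le_pow₀ (by norm_num)) hu1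
  -- `8 ^ n = 2 ^ n * 4 ^ n` and `2 ^ n ≥ 4`; this uses `2 ≤ n`.
  have hbr : 4 * (4 ^ n * (B ^ u + 1)) ≤ K ^ t := by
    rw [hKt, h8, mul_assoc]
    gcongr
  have hKp : K ^ p = K ^ (p - t) * K ^ t := by
    rw [← Real.rpow_add hK]; ring_nf
  have hKpt : 0 < K ^ (p - t) := by positivity
  by_cases hc : K ^ t / 2 ≤ (2 ^ n * b) ^ u
  · have h1 : (K ^ t / 2) ^ (p / t) ≤ ((2 ^ n * b) ^ u) ^ (p / t) :=
      Real.rpow_le_rpow (by positivity) hc (by positivity)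
    rw [← Real.rpow_mul (by positivity), mul_comm u, htu, Real.rpow_one,
      Real.div_rpow (by positivity) (by positivity), ← Real.rpow_mul hK.le,
      mul_div_cancel₀ _ ht.ne', div_le_iff₀ (by positivity)] at h1
    have : 0 ≤ 4 * 2 ^ n * B ^ u * K ^ (p - t) * a := by positivity
    linarith
  · push Not at hc
    have h1 : K ^ t / 4 ≤ 2 ^ n * B ^ u * a := by
      rw [h4] at *
      nlinarith
    have h2 := mul_le_mul_of_nonneg_left h1 hKpt.le
    have : 0 ≤ 2 ^ n * (2 : ℝ) ^ (p / t) * b := by positivity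
    rw [hKp]
    linarith

/-- Homogeneity: dividing by `ℓ ^ p` reduces the level `ℓ` to the level 1. -/
theorem rpow_le_of_reverse_holder {n : ℕ} (hn : 2 ≤ n) {p t B K ℓ A a b' b : ℝ} (ht : 0 < t)
    (htp : t < p) (hB : 0 < B) (hK : 0 < K) (hKt : K ^ t = 8 ^ n * (B ^ (t / p) + 1))
    (hℓ : 0 < ℓ) (ha : 0 ≤ a) (hb : 0 ≤ b) (hA0 : 0 ≤ A)
    (hA : A ≤ 2 ^ n * ℓ ^ t + a) (hb' : b' ≤ 2 ^ n * ℓ ^ p + b)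
    (h : (1 / 2) ^ n * (K ^ p * ℓ ^ p) ≤ B * A ^ (p / t) + b') :
    K ^ p * ℓ ^ p ≤ 4 * 2 ^ n * B ^ (t / p) * K ^ (p - t) * (ℓ ^ (p - t) * a)
      + 2 ^ n * (2 : ℝ) ^ (p / t) * b := by
  have hp : 0 < p := ht.trans htp
  have hℓt : 0 < ℓ ^ t := by positivity
  have hℓp : 0 < ℓ ^ p := by positivity
  have hmul : ℓ ^ p * (2 ^ n + a / ℓ ^ t) ^ (p / t) = (2 ^ n * ℓ ^ t + a) ^ (p / t) := by
    have : 2 ^ n * ℓ ^ t + a = ℓ ^ t * (2 ^ n + a / ℓ ^ t) := by field_simp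
    rw [this, Real.mul_rpow hℓt.le (by positivity), ← Real.rpow_mul hℓ.le,
      mul_div_cancel₀ _ ht.ne']
  have key := rpow_le_of_unit_reverse_holder hn ht htp hB hK hKt (a := a / ℓ ^ t)
    (b := b / ℓ ^ p) (by positivity) (by positivity) (by
      refine le_of_mul_le_mul_left ?_ hℓp
      calc ℓ ^ p * ((1 / 2) ^ n * K ^ p) = (1 / 2) ^ n * (K ^ p * ℓ ^ p) := by ring
        _ ≤ B * A ^ (p / t) + b' := h
        _ ≤ B * (2 ^ n * ℓ ^ t + a) ^ (p / t) + (2 ^ n * ℓ ^ p + b) := by gcongr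
        _ = ℓ ^ p * (B * (2 ^ n + a / ℓ ^ t) ^ (p / t) + (2 ^ n + b / ℓ ^ p)) := by
          rw [← hmul]; field_simp)
  have key2 := mul_le_mul_of_nonneg_right key hℓp.le
  refine key2.trans_eq ?_
  rw [Real.rpow_sub hℓ]
  field_simp

/-! ### Integration of the level-set inequality over the levels -/

theorem lintegral_Ioc_mul_rpow_sub_one {γ a b : ℝ} (hγ : 0 ≤ γ) (ha : 0 < a) (hab : a ≤ b) :
    ∫⁻ l in Set.Ioc a b, ENNReal.ofReal (γ * l ^ (γ - 1)) = ENNReal.ofReal (b ^ γ - a ^ γ) := by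
  have hpos : ∀ l ∈ Set.uIcc a b, 0 < l := fun l hl => by
    rw [Set.uIcc_of_le hab] at hl; exact ha.trans_le hl.1
  have hcont : ContinuousOn (fun l : ℝ => γ * l ^ (γ - 1)) (Set.uIcc a b) :=
    continuousOn_const.mul (continuousOn_id.rpow_const fun l hl => Or.inl (hpos l hl).ne')
  have hint : IntervalIntegrable (fun l : ℝ => γ * l ^ (γ - 1)) volume a b :=
    hcont.intervalIntegrable
  rw [← ofReal_integral_eq_lintegral_ofReal, ← intervalIntegral.integral_of_le hab,
    intervalIntegral.integral_eq_sub_of_hasDerivAt (f := fun l : ℝ => l ^ γ)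
      (fun l hl => Real.hasDerivAt_rpow_const (Or.inl (hpos l hl).ne')) hint]
  · exact (intervalIntegrable_iff_integrableOn_Ioc_of_le hab).1 hint
  · filter_upwards [ae_restrict_mem measurableSet_Ioc] with l hl
    have : 0 < l := ha.trans hl.1
    positivity

/-- Layer-cake formula for a power of `f` clipped to `[a, N]`. -/
theorem lintegral_Ioc_mul_lintegral_lt {X : Type*} [MeasurableSpace X] {μ : Measure X} [SFinite μ]
    {f W : X → ℝ} (hf : Measurable f) (hW : Measurable W) (hW0 : ∀ x, 0 ≤ W x)
    {γ a N : ℝ} (hγ : 0 ≤ γ) (ha : 0 < a) (haN : a ≤ N) :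
    ∫⁻ l in Set.Ioc a N, ENNReal.ofReal (γ * l ^ (γ - 1)) *
        ∫⁻ x in {x | l < f x}, ENNReal.ofReal (W x) ∂μ =
      ∫⁻ x, ENNReal.ofReal (W x * (min (max (f x) a) N ^ γ - a ^ γ)) ∂μ := by
  have hmeas : MeasurableSet {z : ℝ × X | z.1 < f z.2} :=
    measurableSet_lt measurable_fst (hf.comp measurable_snd)
  have h1 : ∀ l : ℝ, ENNReal.ofReal (γ * l ^ (γ - 1)) *
      ∫⁻ x in {x | l < f x}, ENNReal.ofReal (W x) ∂μ =
      ∫⁻ x, {z : ℝ × X | z.1 < f z.2}.indicator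
        (fun z => ENNReal.ofReal (γ * z.1 ^ (γ - 1)) * ENNReal.ofReal (W z.2)) (l, x) ∂μ := by
    intro l
    have hml : MeasurableSet {x | l < f x} := measurableSet_lt measurable_const hf
    rw [← lintegral_indicator hml, ← lintegral_const_mul _ (hW.ennreal_ofReal.indicator hml)]
    refine lintegral_congr fun x => ?_
    by_cases h : l < f x <;> simp [Set.indicator, h]
  simp_rw [h1]
  rw [lintegral_lintegral_swap]
  · refine lintegral_congr fun x => ?_
    set b := min (max (f x) a) N with hb
    have hab : a ≤ b := le_min (le_max_right _ _) haN
    have h2 : ∀ l : ℝ, {z : ℝ × X | z.1 < f z.2}.indicator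
        (fun z => ENNReal.ofReal (γ * z.1 ^ (γ - 1)) * ENNReal.ofReal (W z.2)) (l, x) =
        (Set.Iio (f x)).indicator
          (fun l => ENNReal.ofReal (W x) * ENNReal.ofReal (γ * l ^ (γ - 1))) l := by
      intro l
      by_cases h : l < f x <;> simp [Set.indicator, h, mul_comm]
    simp_rw [h2]
    rw [lintegral_indicator measurableSet_Iio, Measure.restrict_restrict measurableSet_Iio]
    -- Only the endpoint `l = f x` distinguishes the two sets; if `f x ≤ a` both are empty.
    have hae : (Set.Iio (f x) ∩ Set.Ioc a N : Set ℝ) =ᵐ[volume] Set.Ioc a b := by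
      have h3 : (Set.Iic (f x) ∩ Set.Ioc a N : Set ℝ) = Set.Ioc a b := by
        ext l
        simp only [Set.mem_inter_iff, Set.mem_Iic, Set.mem_Ioc, hb, le_min_iff, le_max_iff]
        constructor
        · rintro ⟨h1, h2, h3⟩
          exact ⟨h2, Or.inl h1, h3⟩
        · rintro ⟨h1, h2 | h2, h3⟩
          · exact ⟨h2, h1, h3⟩
          · exact absurd h2 (not_le.2 h1)
      rw [← h3]
      exact Iio_ae_eq_Iic.inter (ae_eq_refl _)
    rw [setLIntegral_congr hae, lintegral_const_mul' _ _ ENNReal.ofReal_ne_top,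
      lintegral_Ioc_mul_rpow_sub_one hγ ha hab, ENNReal.ofReal_mul (hW0 x)]
  · refine (Measurable.indicator ?_ hmeas).aemeasurable
    fun_prop

/-- Clipping at `N` bounds the second factor, so every term that is later absorbed is finite. -/
theorem integrable_mul_clip_rpow_sub {X : Type*} [MeasurableSpace X] {μ : Measure X}
    {f W : X → ℝ} (hf : Measurable f) (hW : Measurable W) (hW0 : ∀ x, 0 ≤ W x)
    (hWi : Integrable W μ) {γ a N : ℝ} (hγ : 0 ≤ γ) (ha : 0 < a) (haN : a ≤ N) :
    Integrable (fun x => W x * (min (max (f x) a) N ^ γ - a ^ γ)) μ ∧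
      ∀ x, 0 ≤ W x * (min (max (f x) a) N ^ γ - a ^ γ) := by
  have hnn : ∀ x, 0 ≤ min (max (f x) a) N ^ γ - a ^ γ := fun x =>
    sub_nonneg.2 (Real.rpow_le_rpow ha.le (le_min (le_max_right _ _) haN) hγ)
  refine ⟨?_, fun x => mul_nonneg (hW0 x) (hnn x)⟩
  refine Integrable.mono' (hWi.mul_const (N ^ γ)) (by fun_prop) (Filter.Eventually.of_forall ?_)
  intro x
  rw [Real.norm_of_nonneg (mul_nonneg (hW0 x) (hnn x))]
  refine mul_le_mul_of_nonneg_left ?_ (hW0 x)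
  have h1 : min (max (f x) a) N ^ γ ≤ N ^ γ :=
    Real.rpow_le_rpow (ha.le.trans (le_min (le_max_right _ _) haN)) (min_le_right _ _) hγ
  have h2 : 0 ≤ a ^ γ := by positivity
  linarith

/-- Integration of the level-set inequality, for the truncation of `f` at height `N`. -/
theorem integral_mul_min_rpow_le {X : Type*} [MeasurableSpace X] {μ : Measure X} [SFinite μ]
    {f g : X → ℝ} (hf : Measurable f) (hg : Measurable g) (hf0 : ∀ x, 0 ≤ f x)
    (hg0 : ∀ x, 0 ≤ g x) {p q t k a N : ℝ} (htp : t < p) (hpq : p ≤ q) (hk : 1 ≤ k)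
    (hD : 0 < q - t - k * (q - p)) (ha : 0 < a) (haN : a ≤ N)
    (hfp : Integrable (fun x => f x ^ p) μ) (hft : Integrable (fun x => f x ^ t) μ)
    (hgp : Integrable (fun x => g x ^ p) μ) (hgq : Integrable (fun x => g x ^ q) μ)
    (hlev : ∀ l, a ≤ l → ∫⁻ x in {x | l < f x}, ENNReal.ofReal (f x ^ p) ∂μ ≤
      ENNReal.ofReal k * (ENNReal.ofReal (l ^ (p - t)) *
          ∫⁻ x in {x | l < f x}, ENNReal.ofReal (f x ^ t) ∂μ +
        ∫⁻ x in {x | l < g x}, ENNReal.ofReal (g x ^ p) ∂μ)) :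
    Integrable (fun x => f x ^ p * min (f x) N ^ (q - p)) μ ∧
    (q - t - k * (q - p)) * ∫ x, f x ^ p * min (f x) N ^ (q - p) ∂μ ≤
      (p - t) * a ^ (q - p) * ∫ x, f x ^ p ∂μ + k * (q - t) * ∫ x, g x ^ q ∂μ := by
  have hqp : 0 ≤ q - p := sub_nonneg.2 hpq
  have hqt : 0 < q - t := by linarith
  have hN : 0 < N := ha.trans_le haN
  have hfp0 : ∀ x, 0 ≤ f x ^ p := fun x => Real.rpow_nonneg (hf0 x) _
  have hft0 : ∀ x, 0 ≤ f x ^ t := fun x => Real.rpow_nonneg (hf0 x) _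
  have hgp0 : ∀ x, 0 ≤ g x ^ p := fun x => Real.rpow_nonneg (hg0 x) _
  have hgq0 : ∀ x, 0 ≤ g x ^ q := fun x => Real.rpow_nonneg (hg0 x) _
  have hfpm : Measurable fun x => f x ^ p := hf.pow_const _
  have hftm : Measurable fun x => f x ^ t := hf.pow_const _
  have hgpm : Measurable fun x => g x ^ p := hg.pow_const _
  obtain ⟨hi1, hn1⟩ := integrable_mul_clip_rpow_sub hf hfpm hfp0 hfp hqp ha haN
  obtain ⟨hi2, hn2⟩ := integrable_mul_clip_rpow_sub hf hftm hft0 hft hqt.le ha haN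
  obtain ⟨hi3, hn3⟩ := integrable_mul_clip_rpow_sub hg hgpm hgp0 hgp hqp ha haN
  set a1 := ∫ x, f x ^ p * (min (max (f x) a) N ^ (q - p) - a ^ (q - p)) ∂μ with ha1
  set h1 := ∫ x, f x ^ t * (min (max (f x) a) N ^ (q - t) - a ^ (q - t)) ∂μ with hh1
  set g1 := ∫ x, g x ^ p * (min (max (g x) a) N ^ (q - p) - a ^ (q - p)) ∂μ with hg1
  have hh10 : 0 ≤ h1 := integral_nonneg hn2
  have hg10 : 0 ≤ g1 := integral_nonneg hn3
  have hmf : MeasurableSet {x | a < f x} := measurableSet_lt measurable_const hf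
  have hmg : MeasurableSet {x | a < g x} := measurableSet_lt measurable_const hg
  set a0 := ∫ x in {x | a < f x}, f x ^ p ∂μ with ha0
  set h0 := ∫ x in {x | a < f x}, f x ^ t ∂μ with hh0
  set g0 := ∫ x in {x | a < g x}, g x ^ p ∂μ with hg0'
  have hh00 : 0 ≤ h0 := integral_nonneg hft0
  have hg00 : 0 ≤ g0 := integral_nonneg hgp0
  have hapow : 0 ≤ a ^ (q - p) := by positivity
  have lint : ∀ {F : X → ℝ} {ν : Measure X}, Integrable F ν → (∀ x, 0 ≤ F x) →
      ∫⁻ x, ENNReal.ofReal (F x) ∂ν = ENNReal.ofReal (∫ x, F x ∂ν) := fun h h' =>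
    (ofReal_integral_eq_lintegral_ofReal h (Filter.Eventually.of_forall h')).symm
  -- the inequality at the level `a`
  have e0 : a0 ≤ k * (a ^ (p - t) * h0 + g0) := by
    have := hlev a le_rfl
    rw [lint hfp.integrableOn hfp0, lint hft.integrableOn hft0, lint hgp.integrableOn hgp0,
      ← ENNReal.ofReal_mul (by positivity), ← ENNReal.ofReal_add (by positivity) (by positivity),
      ← ENNReal.ofReal_mul (by positivity), ENNReal.ofReal_le_ofReal_iff (by positivity)] at this
    exact this
  -- the inequality integrated over the levels
  have e1 : (q - t) * a1 ≤ k * ((q - p) * h1 + (q - t) * g1) := by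
    have hI : ∫⁻ l in Set.Ioc a N, ENNReal.ofReal ((q - p) * l ^ (q - p - 1)) *
          ∫⁻ x in {x | l < f x}, ENNReal.ofReal (f x ^ p) ∂μ ≤
        ∫⁻ l in Set.Ioc a N, (ENNReal.ofReal (k * ((q - p) / (q - t))) *
          (ENNReal.ofReal ((q - t) * l ^ (q - t - 1)) *
            ∫⁻ x in {x | l < f x}, ENNReal.ofReal (f x ^ t) ∂μ) +
          ENNReal.ofReal k * (ENNReal.ofReal ((q - p) * l ^ (q - p - 1)) *
            ∫⁻ x in {x | l < g x}, ENNReal.ofReal (g x ^ p) ∂μ)) := by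
      refine setLIntegral_mono' measurableSet_Ioc fun l hl => ?_
      have hl0 : 0 < l := ha.trans hl.1
      refine (mul_le_mul_right (hlev l hl.1.le) _).trans_eq ?_
      have hpow : l ^ (q - t - 1) = l ^ (q - p - 1) * l ^ (p - t) := by
        rw [← Real.rpow_add hl0]; ring_nf
      have hc : ENNReal.ofReal ((q - p) * l ^ (q - p - 1)) * (ENNReal.ofReal k *
          ENNReal.ofReal (l ^ (p - t))) = ENNReal.ofReal (k * ((q - p) / (q - t))) *
          ENNReal.ofReal ((q - t) * l ^ (q - t - 1)) := by
        rw [← ENNReal.ofReal_mul (by positivity), ← ENNReal.ofReal_mul (by positivity),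
          ← ENNReal.ofReal_mul (by positivity), hpow]
        congr 1
        field_simp
      rw [mul_add, mul_add, ← mul_assoc (ENNReal.ofReal k), ← mul_assoc, hc]
      ring
    have hanti : ∀ {F W : X → ℝ}, Antitone fun l : ℝ =>
        ∫⁻ x in {x | l < F x}, ENNReal.ofReal (W x) ∂μ := fun {F W} l l' hll =>
      lintegral_mono_set fun x (hx : l' < F x) => hll.trans_lt hx
    have hm1 : Measurable fun l : ℝ => ENNReal.ofReal (k * ((q - p) / (q - t))) *
          (ENNReal.ofReal ((q - t) * l ^ (q - t - 1)) *
            ∫⁻ x in {x | l < f x}, ENNReal.ofReal (f x ^ t) ∂μ) :=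
      ((ENNReal.measurable_ofReal.comp (by fun_prop)).mul hanti.measurable).const_mul _
    rw [lintegral_add_left hm1, lintegral_const_mul' _ _ ENNReal.ofReal_ne_top,
      lintegral_const_mul' _ _ ENNReal.ofReal_ne_top,
      lintegral_Ioc_mul_lintegral_lt hf hfpm hfp0 hqp ha haN,
      lintegral_Ioc_mul_lintegral_lt hf hftm hft0 hqt.le ha haN,
      lintegral_Ioc_mul_lintegral_lt hg hgpm hgp0 hqp ha haN, lint hi1 hn1, lint hi2 hn2,
      lint hi3 hn3, ← ENNReal.ofReal_mul (by positivity), ← ENNReal.ofReal_mul (by positivity),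
      ← ENNReal.ofReal_add (by positivity) (by positivity),
      ENNReal.ofReal_le_ofReal_iff (by positivity)] at hI
    calc (q - t) * a1 ≤ (q - t) * (k * ((q - p) / (q - t)) * h1 + k * g1) := by gcongr
      _ = _ := by field_simp
  -- pointwise comparisons
  have hmul : ∀ {y : ℝ} (r s : ℝ), 0 < y → y ^ r * y ^ s = y ^ (r + s) := fun r s hy =>
    (Real.rpow_add hy r s).symm
  -- Adding the boundary terms at level `a` cancels the subtracted powers of `a`. What remains is `f
  -- ^ t * m ^ (q - t) ≤ f ^ p * m ^ (q - p)` on `{a < f}`, true because `m ≤ f`. This is the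
  -- comparison that permits absorption.
  have e2 : h1 + a ^ (q - t) * h0 ≤ a1 + a ^ (q - p) * a0 := by
    rw [hh1, hh0, ha1, ha0, ← integral_indicator hmf, ← integral_indicator hmf,
      ← integral_const_mul, ← integral_const_mul,
      ← integral_add hi2 ((hft.indicator hmf).const_mul _),
      ← integral_add hi1 ((hfp.indicator hmf).const_mul _)]
    refine integral_mono (hi2.add ((hft.indicator hmf).const_mul _))
      (hi1.add ((hfp.indicator hmf).const_mul _)) fun x => ?_
    by_cases hx : a < f x
    · have hfx : 0 < f x := ha.trans hx
      simp only [Set.indicator, Set.mem_ofPred_eq, hx, if_true, max_eq_left hx.le]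
      set m := min (f x) N with hm
      have hm0 : 0 < m := lt_min hfx hN
      have : f x ^ t * m ^ (q - t) ≤ f x ^ p * m ^ (q - p) := by
        have h2 : m ^ (q - t) = m ^ (p - t) * m ^ (q - p) := by rw [hmul _ _ hm0]; ring_nf
        have h3 : f x ^ p = f x ^ t * f x ^ (p - t) := by rw [hmul _ _ hfx]; ring_nf
        rw [h2, h3, mul_assoc]
        gcongr
        exact min_le_left _ _
      nlinarith
    · have : max (f x) a = a := max_eq_right (not_lt.1 hx)
      simp [Set.indicator, hx, this, min_eq_left haN]
  have e3 : g1 + a ^ (q - p) * g0 ≤ ∫ x, g x ^ q ∂μ := by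
    rw [hg1, hg0', ← integral_indicator hmg, ← integral_const_mul,
      ← integral_add hi3 ((hgp.indicator hmg).const_mul _)]
    refine integral_mono (hi3.add ((hgp.indicator hmg).const_mul _)) hgq fun x => ?_
    by_cases hx : a < g x
    · have hgx : 0 < g x := ha.trans hx
      simp only [Set.indicator, Set.mem_ofPred_eq, hx, if_true, max_eq_left hx.le]
      set m := min (g x) N with hm
      have hm0 : 0 < m := lt_min hgx hN
      have : g x ^ p * m ^ (q - p) ≤ g x ^ q := by
        have h3 : g x ^ q = g x ^ p * g x ^ (q - p) := by rw [hmul _ _ hgx]; ring_nf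
        rw [h3]
        gcongr
        exact min_le_left _ _
      nlinarith
    · have : max (g x) a = a := max_eq_right (not_lt.1 hx)
      simpa [Set.indicator, hx, this, min_eq_left haN] using hgq0 x
  have hi4 : Integrable (fun x => f x ^ p * min (f x) N ^ (q - p)) μ := by
    refine Integrable.mono' (hfp.mul_const (N ^ (q - p))) (by fun_prop)
      (Filter.Eventually.of_forall fun x => ?_)
    have hm0 : 0 ≤ min (f x) N := le_min (hf0 x) hN.le
    rw [Real.norm_of_nonneg (mul_nonneg (hfp0 x) (by positivity))]
    refine mul_le_mul_of_nonneg_left ?_ (hfp0 x)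
    exact Real.rpow_le_rpow hm0 (min_le_right _ _) hqp
  refine ⟨hi4, ?_⟩
  have e4 : ∫ x, f x ^ p * min (f x) N ^ (q - p) ∂μ ≤ a1 + a ^ (q - p) * ∫ x, f x ^ p ∂μ := by
    rw [ha1, ← integral_const_mul, ← integral_add hi1 (hfp.const_mul _)]
    refine integral_mono hi4 (hi1.add (hfp.const_mul _)) fun x => ?_
    have hm0 : 0 ≤ min (f x) N := le_min (hf0 x) hN.le
    have : min (f x) N ^ (q - p) ≤ min (max (f x) a) N ^ (q - p) :=
      Real.rpow_le_rpow hm0 (min_le_min_right _ (le_max_left _ _)) hqp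
    have := mul_le_mul_of_nonneg_left this (hfp0 x)
    dsimp only
    linarith
  have e5 : a0 ≤ ∫ x, f x ^ p ∂μ := setIntegral_le_integral hfp (Filter.Eventually.of_forall hfp0)
  set P := ∫ x, f x ^ p ∂μ
  set G := ∫ x, g x ^ q ∂μ
  set Y := ∫ x, f x ^ p * min (f x) N ^ (q - p) ∂μ
  have hapt : a ^ (q - t) = a ^ (q - p) * a ^ (p - t) := by rw [hmul _ _ ha]; ring_nf
  have hDle : q - t - k * (q - p) ≤ p - t := by nlinarith
  -- `e1` plus `(q - p) * a ^ (q - p)` times `e0`: exactly the boundary terms needed for `e2` and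
  -- `e3`.
  have s1 : (q - t) * a1 + (q - p) * a ^ (q - p) * a0 ≤
      k * (q - p) * (h1 + a ^ (q - t) * h0) + k * (q - t) * (g1 + a ^ (q - p) * g0) := by
    have := mul_le_mul_of_nonneg_left e0 (mul_nonneg hqp hapow)
    have h5 : k * ((q - p) * (a ^ (q - p) * g0)) ≤ k * ((q - t) * (a ^ (q - p) * g0)) := by
      gcongr
    rw [hapt]
    linarith
  have s2 := mul_le_mul_of_nonneg_left e2 (by positivity : 0 ≤ k * (q - p))
  have s3 := mul_le_mul_of_nonneg_left e3 (by positivity : 0 ≤ k * (q - t))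
  have s4 := mul_le_mul_of_nonneg_left e4 hD.le
  have s5 : (q - t - k * (q - p)) * (a ^ (q - p) * (P - a0)) ≤
      (p - t) * (a ^ (q - p) * (P - a0)) :=
    mul_le_mul_of_nonneg_right hDle (mul_nonneg hapow (sub_nonneg.2 e5))
  -- After absorption `a ^ (q - p) * a0` has coefficient `(k - 1) * (q - p)`; with the `q - t - k *
  -- (q - p)` coming from `s4` this adds up to `p - t`. The rest, `P - a0`, is handled by `s5`.
  linarith

/-- The truncated bound does not depend on the height. Fatou's lemma along the heights `a + m`
removes the truncation and yields integrability of `f ^ q`, which is not assumed. -/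
theorem integral_rpow_le_of_level {X : Type*} [MeasurableSpace X] {μ : Measure X} [SFinite μ]
    {f g : X → ℝ} (hf : Measurable f) (hg : Measurable g) (hf0 : ∀ x, 0 ≤ f x)
    (hg0 : ∀ x, 0 ≤ g x) {p q t k a : ℝ} (ht : 0 < t) (htp : t < p) (hpq : p ≤ q) (hk : 1 ≤ k)
    (hD : 0 < q - t - k * (q - p)) (ha : 0 < a)
    (hfp : Integrable (fun x => f x ^ p) μ) (hft : Integrable (fun x => f x ^ t) μ)
    (hgp : Integrable (fun x => g x ^ p) μ) (hgq : Integrable (fun x => g x ^ q) μ)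
    (hlev : ∀ l, a ≤ l → ∫⁻ x in {x | l < f x}, ENNReal.ofReal (f x ^ p) ∂μ ≤
      ENNReal.ofReal k * (ENNReal.ofReal (l ^ (p - t)) *
          ∫⁻ x in {x | l < f x}, ENNReal.ofReal (f x ^ t) ∂μ +
        ∫⁻ x in {x | l < g x}, ENNReal.ofReal (g x ^ p) ∂μ)) :
    Integrable (fun x => f x ^ q) μ ∧
    (q - t - k * (q - p)) * ∫ x, f x ^ q ∂μ ≤
      (p - t) * a ^ (q - p) * ∫ x, f x ^ p ∂μ + k * (q - t) * ∫ x, g x ^ q ∂μ := by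
  set C := (p - t) * a ^ (q - p) * ∫ x, f x ^ p ∂μ + k * (q - t) * ∫ x, g x ^ q ∂μ with hC
  set D := q - t - k * (q - p) with hDdef
  have hlim : ∀ x, ∃ M : ℕ, ∀ m ≥ M, f x ^ p * min (f x) (a + m) ^ (q - p) = f x ^ q := by
    intro x
    obtain ⟨M, hM⟩ := exists_nat_ge (f x)
    refine ⟨M, fun m hm => ?_⟩
    have hm' : (M : ℝ) ≤ m := by exact_mod_cast hm
    rw [min_eq_left (by linarith)]
    rcases (hf0 x).eq_or_lt with h | h
    · rw [← h, Real.zero_rpow (x := p) (by linarith), Real.zero_rpow (x := q) (by linarith), zero_mul]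
    · rw [← Real.rpow_add h]; ring_nf
  have hbd : ∫⁻ x, ENNReal.ofReal (f x ^ q) ∂μ ≤ ENNReal.ofReal (C / D) := by
    have h1 : ∀ x, ENNReal.ofReal (f x ^ q) = Filter.liminf (fun m : ℕ =>
        ENNReal.ofReal (f x ^ p * min (f x) (a + m) ^ (q - p))) Filter.atTop := by
      intro x
      obtain ⟨M, hM⟩ := hlim x
      refine (Filter.Tendsto.liminf_eq (tendsto_const_nhds.congr' ?_)).symm
      filter_upwards [Filter.eventually_ge_atTop M] with m hm
      rw [hM m hm]
    simp_rw [h1]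
    refine (lintegral_liminf_le fun m => by fun_prop).trans ?_
    refine Filter.liminf_le_of_frequently_le' (Filter.Eventually.of_forall fun m => ?_).frequently
    have haN : a ≤ a + m := le_add_of_nonneg_right m.cast_nonneg
    obtain ⟨hi, hle⟩ := integral_mul_min_rpow_le hf hg hf0 hg0 htp hpq hk hD ha haN hfp hft hgp
      hgq hlev
    rw [← ofReal_integral_eq_lintegral_ofReal hi (Filter.Eventually.of_forall fun x =>
      mul_nonneg (Real.rpow_nonneg (hf0 x) _)
        (Real.rpow_nonneg (le_min (hf0 x) (ha.le.trans haN)) _))]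
    refine ENNReal.ofReal_le_ofReal ?_
    rw [le_div_iff₀ hD, mul_comm]
    exact hle
  have hfq0 : ∀ x, 0 ≤ f x ^ q := fun x => Real.rpow_nonneg (hf0 x) _
  have hint : Integrable (fun x => f x ^ q) μ := by
    refine ⟨(hf.pow_const _).aestronglyMeasurable, ?_⟩
    rw [hasFiniteIntegral_iff_ofReal (Filter.Eventually.of_forall hfq0)]
    exact hbd.trans_lt ENNReal.ofReal_lt_top
  refine ⟨hint, ?_⟩
  rw [← ofReal_integral_eq_lintegral_ofReal hint (Filter.Eventually.of_forall hfq0)] at hbd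
  have hC0 : 0 ≤ C := by
    have h1 : 0 ≤ ∫ x, f x ^ p ∂μ := integral_nonneg fun x => Real.rpow_nonneg (hf0 x) _
    have h2 : 0 ≤ ∫ x, g x ^ q ∂μ := integral_nonneg fun x => Real.rpow_nonneg (hg0 x) _
    have h3 : 0 ≤ p - t := by linarith
    have h4 : 0 ≤ q - t := by linarith
    positivity
  rw [ENNReal.ofReal_le_ofReal_iff (by positivity), le_div_iff₀ hD, mul_comm] at hbd
  exact hbd

/-! ### The weight, the stopping-time argument and the level-set inequality -/

/-- The normalised distance of `x` to the complement of `Metric.ball x₀ r`. -/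
noncomputable def weight {n : ℕ} (x₀ : Fin n → ℝ) (r : ℝ) (x : Fin n → ℝ) : ℝ :=
  max 0 (1 - dist x x₀ / r)

section weight

variable {n : ℕ} {x₀ : Fin n → ℝ} {r : ℝ}

theorem continuous_weight : Continuous (weight x₀ r) := by
  unfold weight; fun_prop

theorem weight_nonneg (x : Fin n → ℝ) : 0 ≤ weight x₀ r x := le_max_left _ _

theorem weight_le_one (hr : 0 < r) (x : Fin n → ℝ) : weight x₀ r x ≤ 1 :=
  max_le zero_le_one (by have : 0 ≤ dist x x₀ / r := by positivity
                         linarith)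

theorem mul_weight_of_mem (hr : 0 < r) {x : Fin n → ℝ} (hx : x ∈ Metric.ball x₀ r) :
    r * weight x₀ r x = r - dist x x₀ := by
  have : dist x x₀ / r < 1 := (div_lt_one hr).2 hx
  rw [weight, max_eq_right (by linarith)]
  field_simp

theorem mem_ball_of_weight_pos (hr : 0 < r) {x : Fin n → ℝ} (hx : 0 < weight x₀ r x) :
    x ∈ Metric.ball x₀ r := by
  rcases lt_max_iff.1 hx with h | h
  · exact absurd h (lt_irrefl _)
  · exact (div_lt_one hr).1 (by linarith)

theorem weight_rpow_rpow {p : ℝ} (hp : 0 < p) {w : ℝ} (hw : 0 ≤ w) :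
    (w ^ ((n : ℝ) / p)) ^ p = w ^ n := by
  rw [← Real.rpow_mul hw, div_mul_cancel₀ _ hp.ne', Real.rpow_natCast]

end weight

/-- Values not exceeding `ℓ` contribute at most `ℓ ^ e` times the measure. -/
theorem setIntegral_rpow_le_trunc {X : Type*} [MeasurableSpace X] {μ : Measure X} {h : X → ℝ}
    (hh : Measurable h) (hh0 : ∀ x, 0 ≤ h x) {e ℓ : ℝ} (he : 0 < e) (hℓ : 0 < ℓ)
    (hi : Integrable (fun x => h x ^ e) μ) {s : Set X} (hμs : μ s ≠ ⊤) :
    ∫ x in s, h x ^ e ∂μ ≤ μ.real s * ℓ ^ e + ∫ x in s ∩ {x | ℓ < h x}, h x ^ e ∂μ := by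
  have hm : MeasurableSet {x | ℓ < h x} := measurableSet_lt measurable_const hh
  rw [Set.inter_comm, ← Measure.restrict_restrict hm, ← integral_indicator hm, ← smul_eq_mul,
    ← setIntegral_const]
  have hc : Integrable (fun _ : X => ℓ ^ e) (μ.restrict s) := integrableOn_const hμs
  have hind : Integrable ({x | ℓ < h x}.indicator fun x => h x ^ e) (μ.restrict s) :=
    hi.restrict.indicator hm
  rw [← integral_add hc hind]
  refine integral_mono hi.restrict (hc.add hind) fun x => ?_
  by_cases hx : ℓ < h x
  · simp only [Set.indicator, Set.mem_ofPred_eq, hx, if_true]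
    have : 0 < ℓ ^ e := by positivity
    linarith
  · simp only [Set.indicator, Set.mem_ofPred_eq, hx, if_false, add_zero]
    exact Real.rpow_le_rpow (hh0 x) (not_lt.1 hx) he.le

/-- Transfers superlevel integrals from the unweighted to the weighted function where the weight
factor is at least `w`: there `h > ℓ` forces `f > w * ℓ`. -/
theorem mul_setIntegral_superlevel_le {X : Type*} [MeasurableSpace X] {μ : Measure X}
    {h f : X → ℝ} (hh : Measurable h) (hf : Measurable f) (hh0 : ∀ x, 0 ≤ h x)
    (hf0 : ∀ x, 0 ≤ f x) {e ℓ w : ℝ} (he : 0 < e) (hw : 0 < w)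
    (hi : Integrable (fun x => h x ^ e) μ)
    (hfi : Integrable (fun x => f x ^ e) μ) {s : Set X} (hs : MeasurableSet s)
    (hle : ∀ x ∈ s, w * h x ≤ f x) :
    w ^ e * ∫ x in s ∩ {x | ℓ < h x}, h x ^ e ∂μ ≤ ∫ x in s ∩ {x | w * ℓ < f x}, f x ^ e ∂μ := by
  have hm : MeasurableSet {x | ℓ < h x} := measurableSet_lt measurable_const hh
  have hm' : MeasurableSet {x | w * ℓ < f x} := measurableSet_lt measurable_const hf
  rw [← integral_const_mul]
  calc ∫ x in s ∩ {x | ℓ < h x}, w ^ e * h x ^ e ∂μ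
      ≤ ∫ x in s ∩ {x | ℓ < h x}, f x ^ e ∂μ := by
        refine setIntegral_mono_on (hi.const_mul _).integrableOn hfi.integrableOn (hs.inter hm)
          fun x hx => ?_
        rw [← Real.mul_rpow hw.le (hh0 x)]
        exact Real.rpow_le_rpow (mul_nonneg hw.le (hh0 x)) (hle x hx.1) he.le
    _ ≤ ∫ x in s ∩ {x | w * ℓ < f x}, f x ^ e ∂μ := by
        refine setIntegral_mono_set hfi.integrableOn
          (Filter.Eventually.of_forall fun x => Real.rpow_nonneg (hf0 x) _) ?_
        refine LE.le.eventuallyLE fun x hx => ⟨hx.1, ?_⟩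
        exact (mul_lt_mul_of_pos_left hx.2 hw).trans_le (hle x hx.1)

set_option maxHeartbeats 1000000 in
/-- The stopping-time step: around a point where the weighted function exceeds `K * l`, one finds
a ball on which the reverse Hölder inequality turns into an estimate by superlevel sets. -/
theorem exists_ball_setIntegral_le {n : ℕ} (hn : 2 ≤ n) {x₀ : Fin n → ℝ} {r : ℝ} (hr : 0 < r)
    {p t α B K : ℝ} (ht : 0 < t) (htp : t < p) (hα : 1 / 2 ≤ α) (hα1 : α < 1) (hB : 0 < B)
    (hK : 0 < K) (hKt : K ^ t = 8 ^ n * (B ^ (t / p) + 1)) (hKp : 8 ^ n ≤ K ^ p)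
    {φ ψ : (Fin n → ℝ) → ℝ} (hφ : Measurable φ) (hψ : Measurable ψ) (hφ0 : ∀ x, 0 ≤ φ x)
    (hψ0 : ∀ x, 0 ≤ ψ x) (hφp : Integrable fun x => φ x ^ p) (hφt : Integrable fun x => φ x ^ t)
    (hψp : Integrable fun x => ψ x ^ p)
    (hRH : ∀ z ∈ Metric.ball x₀ r, ∀ R : ℝ, 0 < R → √(n : ℝ) * R < r - dist z x₀ →
      1 / R ^ n * ∫ x in Metric.ball z (α * R), φ x ^ p ≤
        B * (1 / R ^ n * ∫ x in Metric.ball z R, φ x ^ t) ^ (p / t)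
          + 1 / R ^ n * ∫ x in Metric.ball z R, ψ x ^ p)
    {f g : (Fin n → ℝ) → ℝ} (hf : ∀ x, f x = φ x * weight x₀ r x ^ ((n : ℝ) / p))
    (hg : ∀ x, g x = ψ x * weight x₀ r x ^ ((n : ℝ) / p))
    (hfm : Measurable f) (hgm : Measurable g) (hf0 : ∀ x, 0 ≤ f x) (hg0 : ∀ x, 0 ≤ g x)
    (hfp : Integrable fun x => f x ^ p) (hft : Integrable fun x => f x ^ t)
    (hgp : Integrable fun x => g x ^ p) {l : ℝ} (hl : 0 < l)
    (hlarge : (18 * n) ^ n * ∫ x, φ x ^ p ≤ 8 ^ n * l ^ p * r ^ n)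
    {x : Fin n → ℝ} (hx : K * l < f x)
    (hleb : ∀ c < φ x ^ p, ∀ R₁ : ℝ, 0 < R₁ →
      ∃ R : ℝ, 0 < R ∧ R ≤ R₁ ∧ c * (2 * R) ^ n < ∫ y in Metric.ball x R, φ y ^ p) :
    ∃ ρ : ℝ, 0 < ρ ∧ ρ ≤ r ∧ ∫ y in Metric.ball x (3 * ρ), f y ^ p ≤
      12 ^ n * (4 * B ^ (t / p) * K ^ (p - t)) *
        (l ^ (p - t) * ∫ y in Metric.ball x ρ ∩ {y | l < f y}, f y ^ t) +
      12 ^ n * (2 : ℝ) ^ (p / t) * ∫ y in Metric.ball x ρ ∩ {y | l < g y}, g y ^ p := by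
  have hp : 0 < p := ht.trans htp
  have hn0 : (0 : ℝ) < n := by exact_mod_cast (by omega : 0 < n)
  have hn1 : (1 : ℝ) ≤ n := by exact_mod_cast (by omega : 1 ≤ n)
  have hα0 : 0 < α := by linarith
  set d := weight x₀ r x with hd
  have hd0 : 0 < d := by
    rcases (weight_nonneg (x₀ := x₀) (r := r) x).eq_or_lt with h | h
    · rw [hf, ← h, Real.zero_rpow (by positivity), mul_zero] at hx
      exact absurd hx (not_lt.2 (by positivity))
    · exact h
  have hxQ : x ∈ Metric.ball x₀ r := mem_ball_of_weight_pos hr hd0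
  have hd1 : d ≤ 1 := weight_le_one hr x
  have hrd : r * d = r - dist x x₀ := mul_weight_of_mem hr hxQ
  -- On the balls used below the weight differs from `d` by at most `d / 3`, so it lies in `[2d/3,
  -- 4d/3] = [m, 2m]`. The unweighted level matching `l` is therefore `ℓ = l / w`.
  set m := 2 * d / 3 with hm
  have hm0 : 0 < m := by positivity
  set w := m ^ ((n : ℝ) / p) with hw
  have hw0 : 0 < w := by positivity
  have hwp : w ^ p = m ^ n := weight_rpow_rpow hp hm0.le
  set ℓ := l / w with hℓ
  have hℓ0 : 0 < ℓ := by positivity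
  have hwℓ : w * ℓ = l := by rw [hℓ]; field_simp
  have hℓp : ℓ ^ p * m ^ n = l ^ p := by
    rw [← hwp, ← Real.mul_rpow hℓ0.le hw0.le, mul_comm ℓ, hwℓ]
  set T := K ^ p * ℓ ^ p with hT
  have hT0 : 0 < T := by positivity
  have hTm : T * m ^ n = K ^ p * l ^ p := by rw [hT, mul_assoc, hℓp]
  -- the average over small balls exceeds `T`
  have hTx : T / 2 ^ n < φ x ^ p := by
    have h1 : K ^ p * l ^ p < φ x ^ p * d ^ n := by
      rw [← Real.mul_rpow hK.le hl.le, ← weight_rpow_rpow (n := n) hp hd0.le,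
        ← Real.mul_rpow (hφ0 x) (by positivity), ← hf x]
      exact Real.rpow_lt_rpow (by positivity) hx hp
    have h2 : d ^ n ≤ 2 ^ n * m ^ n := by
      rw [← mul_pow]
      exact pow_le_pow_left₀ hd0.le (by rw [hm]; linarith) n
    rw [div_lt_iff₀ (by positivity)]
    refine lt_of_mul_lt_mul_right ?_ (by positivity : 0 ≤ m ^ n)
    calc T * m ^ n < φ x ^ p * d ^ n := by rw [hTm]; exact h1
      _ ≤ φ x ^ p * (2 ^ n * m ^ n) :=
        mul_le_mul_of_nonneg_left h2 (Real.rpow_nonneg (hφ0 x) _)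
      _ = _ := by ring
  -- Since `1 / 2 ≤ α`, the radius `ρ = R / α` is at most `2 * R₁`. Then `3 * ρ ≤ r * d / 3`, which
  -- controls the weight, and `√n * ρ ≤ r * d / 9`, which makes `ρ` admissible in the reverse Hölder
  -- inequality.
  set R₁ := r * d / (18 * n) with hR₁
  have hR₁0 : 0 < R₁ := by positivity
  set S : Set ℝ := {R | 0 < R ∧ R ≤ R₁ ∧ T * R ^ n < ∫ y in Metric.ball x R, φ y ^ p} with hS
  have hSne : S.Nonempty := by
    obtain ⟨R, h1, h2, h3⟩ := hleb _ hTx R₁ hR₁0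
    refine ⟨R, h1, h2, ?_⟩
    rw [mul_pow, ← mul_assoc, div_mul_cancel₀ _ (by positivity)] at h3
    exact h3
  have hSb : BddAbove S := ⟨R₁, fun R hR => hR.2.1⟩
  have hσ : 0 < sSup S := by
    obtain ⟨R, hR⟩ := hSne
    exact hR.1.trans_le (le_csSup hSb hR)
  -- No maximal radius is needed: with `R > sSup S / 3` and `ρ ≥ R`, the radius `3 * ρ` already lies
  -- beyond `S`.
  obtain ⟨R, hRS, hRσ⟩ := exists_lt_of_lt_csSup hSne (by linarith : sSup S / 3 < sSup S)
  obtain ⟨hR0, hRR₁, hRT⟩ := hRS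
  set ρ := R / α with hρ
  have hαρ : α * ρ = R := by rw [hρ]; field_simp
  have hρ0 : 0 < ρ := by positivity
  have hRρ : R ≤ ρ := (le_div_iff₀ hα0).2 (mul_le_of_le_one_right hR0.le hα1.le)
  have hρR₁ : ρ ≤ 2 * R₁ := by
    rw [hρ, div_le_iff₀ hα0]
    have := mul_le_mul_of_nonneg_left hα (by positivity : 0 ≤ 2 * R₁)
    linarith
  have hR₁n : R₁ * (18 * n) = r * d := by rw [hR₁]; field_simp
  have hR₁d : 18 * R₁ ≤ r * d := by
    have := mul_le_mul_of_nonneg_left hn1 hR₁0.le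
    linarith
  have hrd' : r * d ≤ r := mul_le_of_le_one_right hr.le hd1
  refine ⟨ρ, hρ0, by linarith, ?_⟩
  -- the average over the enlarged ball does not exceed `T`
  have hbig : ∫ y in Metric.ball x (3 * ρ), φ y ^ p ≤ T * (3 * ρ) ^ n := by
    by_cases hc : 3 * ρ ≤ R₁
    · by_contra hcon
      have := le_csSup hSb (show 3 * ρ ∈ S from ⟨by positivity, hc, not_le.1 hcon⟩)
      linarith
    · push Not at hc
      have h1 : ∫ y in Metric.ball x (3 * ρ), φ y ^ p ≤ ∫ y, φ y ^ p :=
        setIntegral_le_integral hφp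
          (Filter.Eventually.of_forall fun y => Real.rpow_nonneg (hφ0 y) _)
      have h2 : T * R₁ ^ n ≤ T * (3 * ρ) ^ n := by gcongr
      refine h1.trans (le_trans ?_ h2)
      -- If `3 * ρ > R₁`, the total mass decides: `(18 * n) ^ n * T * R₁ ^ n = T * (r * d) ^ n ≥ K ^
      -- p * l ^ p * r ^ n`, and `K ^ p ≥ 8 ^ n`.
      refine le_of_mul_le_mul_left (hlarge.trans ?_) (by positivity : (0 : ℝ) < (18 * n) ^ n)
      have h3 : (18 * n) ^ n * (T * R₁ ^ n) = T * (r * d) ^ n := by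
        rw [← hR₁n, mul_pow R₁]; ring
      have h4 : T * m ^ n ≤ T * d ^ n := by gcongr; rw [hm]; linarith
      rw [h3, mul_pow, mul_comm (r ^ n), ← mul_assoc]
      refine mul_le_mul_of_nonneg_right (le_trans ?_ h4) (by positivity)
      rw [hTm]
      gcongr
  -- comparison of the weights
  have hwt : ∀ y ∈ Metric.ball x (3 * ρ), m ≤ weight x₀ r y ∧ weight x₀ r y ≤ 2 * m := by
    intro y hy
    rw [Metric.mem_ball] at hy
    have hy' : dist y x < r * d / 3 := by linarith
    have h1 := dist_triangle y x x₀
    have h2 := dist_triangle x y x₀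
    rw [dist_comm x y] at h2
    have hyQ : y ∈ Metric.ball x₀ r := by
      rw [Metric.mem_ball]
      have : 0 < r * d := by positivity
      linarith
    have h3 := mul_weight_of_mem hr hyQ
    rw [hm]
    constructor
    · refine le_of_mul_le_mul_left ?_ hr
      linarith
    · refine le_of_mul_le_mul_left ?_ hr
      linarith
  have hsub : Metric.ball x ρ ⊆ Metric.ball x (3 * ρ) := Metric.ball_subset_ball (by linarith)
  have hwle : ∀ y ∈ Metric.ball x ρ, w ≤ weight x₀ r y ^ ((n : ℝ) / p) := fun y hy =>
    Real.rpow_le_rpow hm0.le (hwt y (hsub hy)).1 (by positivity)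
  -- the reverse Hölder inequality on the ball of radius `ρ`
  have hvol : volume.real (Metric.ball x ρ) = 2 ^ n * ρ ^ n := by
    rw [Measure.real, Real.volume_pi_ball x hρ0, ENNReal.toReal_ofReal (by positivity), mul_pow]
    simp
  have hsqrt : √(n : ℝ) ≤ n := Real.sqrt_le_iff.2 ⟨hn0.le, by nlinarith⟩
  have hrh := hRH x hxQ ρ hρ0 (by
    rw [← hrd]
    have : √(n : ℝ) * ρ ≤ n * (2 * R₁) := by gcongr
    have : 0 < r * d := by positivity
    linarith)
  rw [hαρ] at hrh
  set a := 1 / ρ ^ n * ∫ y in Metric.ball x ρ ∩ {y | ℓ < φ y}, φ y ^ t with ha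
  set b := 1 / ρ ^ n * ∫ y in Metric.ball x ρ ∩ {y | ℓ < ψ y}, ψ y ^ p with hb
  have hρn : 0 < ρ ^ n := by positivity
  have htr : ∀ {h : (Fin n → ℝ) → ℝ} {e : ℝ}, Measurable h → (∀ y, 0 ≤ h y) → 0 < e →
      (Integrable fun y => h y ^ e) → 1 / ρ ^ n * ∫ y in Metric.ball x ρ, h y ^ e ≤
        2 ^ n * ℓ ^ e + 1 / ρ ^ n * ∫ y in Metric.ball x ρ ∩ {y | ℓ < h y}, h y ^ e := by
    intro h e hh hh0 he hi
    have := setIntegral_rpow_le_trunc hh hh0 he hℓ0 hi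
      (measure_ball_lt_top (x := x) (r := ρ)).ne
    rw [hvol] at this
    have := mul_le_mul_of_nonneg_left this (by positivity : 0 ≤ 1 / ρ ^ n)
    refine this.trans_eq ?_
    field_simp
  have harith := rpow_le_of_reverse_holder hn ht htp hB hK hKt hℓ0
    (a := a) (b := b) (by
      have := setIntegral_nonneg (μ := volume)
        (measurableSet_ball.inter (measurableSet_lt measurable_const hφ))
        fun y (_ : y ∈ Metric.ball x ρ ∩ {y | ℓ < φ y}) => Real.rpow_nonneg (hφ0 y) t
      positivity) (by
      have := setIntegral_nonneg (μ := volume)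
        (measurableSet_ball.inter (measurableSet_lt measurable_const hψ))
        fun y (_ : y ∈ Metric.ball x ρ ∩ {y | ℓ < ψ y}) => Real.rpow_nonneg (hψ0 y) p
      positivity) (by
      have := setIntegral_nonneg (μ := volume) measurableSet_ball
        fun y (_ : y ∈ Metric.ball x ρ) => Real.rpow_nonneg (hφ0 y) t
      positivity) (htr hφ hφ0 ht hφt) (htr hψ hψ0 hp hψp) (by
      refine le_trans ?_ hrh
      rw [one_div (ρ ^ n), inv_mul_eq_div, le_div_iff₀ hρn]
      refine le_trans ?_ hRT.le
      -- Passing from radius `R = α * ρ` to `ρ` costs the factor `(1 / 2) ^ n`, as `1 / 2 ≤ α`.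
      have : (1 / 2) ^ n * ρ ^ n ≤ R ^ n := by
        rw [← mul_pow]
        refine pow_le_pow_left₀ (by positivity) ?_ n
        rw [← hαρ]
        gcongr
      calc (1 / 2) ^ n * (K ^ p * ℓ ^ p) * ρ ^ n = T * ((1 / 2) ^ n * ρ ^ n) := by
            rw [hT]; ring
        _ ≤ T * R ^ n := by gcongr)
  have hlt : m ^ n * ℓ ^ (p - t) = l ^ (p - t) * w ^ t := by
    rw [← hwℓ, Real.mul_rpow hw0.le hℓ0.le, ← hwp, Real.rpow_sub hw0]
    field_simp
  have hA : w ^ t * ∫ y in Metric.ball x ρ ∩ {y | ℓ < φ y}, φ y ^ t ≤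
      ∫ y in Metric.ball x ρ ∩ {y | l < f y}, f y ^ t := by
    have := mul_setIntegral_superlevel_le (ℓ := ℓ) hφ hfm hφ0 hf0 ht hw0 hφt hft
      (measurableSet_ball (x := x) (ε := ρ)) fun y hy => by
        rw [hf, mul_comm]
        exact mul_le_mul_of_nonneg_left (hwle y hy) (hφ0 y)
    rwa [hwℓ] at this
  have hBb : m ^ n * ∫ y in Metric.ball x ρ ∩ {y | ℓ < ψ y}, ψ y ^ p ≤
      ∫ y in Metric.ball x ρ ∩ {y | l < g y}, g y ^ p := by
    have := mul_setIntegral_superlevel_le (ℓ := ℓ) hψ hgm hψ0 hg0 hp hw0 hψp hgp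
      (measurableSet_ball (x := x) (ε := ρ)) fun y hy => by
        rw [hg, mul_comm]
        exact mul_le_mul_of_nonneg_left (hwle y hy) (hψ0 y)
    rwa [hwℓ, hwp] at this
  have hf3 : ∫ y in Metric.ball x (3 * ρ), f y ^ p ≤
      (2 * m) ^ n * ∫ y in Metric.ball x (3 * ρ), φ y ^ p := by
    rw [← integral_const_mul]
    refine setIntegral_mono_on hfp.integrableOn (hφp.const_mul _).integrableOn measurableSet_ball
      fun y hy => ?_
    rw [hf, Real.mul_rpow (hφ0 y) (Real.rpow_nonneg (weight_nonneg y) _),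
      weight_rpow_rpow hp (weight_nonneg y), mul_comm]
    exact mul_le_mul_of_nonneg_right (pow_le_pow_left₀ (weight_nonneg y) (hwt y hy).2 n)
      (Real.rpow_nonneg (hφ0 y) _)
  -- One `2 ^ n` comes from the upper bound `2 * m` of the weight, one from the arithmetic estimate,
  -- and `3 ^ n` from the tripled ball.
  have h12 : (12 : ℝ) ^ n = 2 ^ n * (2 ^ n * 3 ^ n) := by
    rw [← mul_pow, ← mul_pow]; norm_num
  calc ∫ y in Metric.ball x (3 * ρ), f y ^ p ≤ (2 * m) ^ n * (T * (3 * ρ) ^ n) :=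
        hf3.trans (mul_le_mul_of_nonneg_left hbig (by positivity))
    _ ≤ (2 * m) ^ n * ((4 * 2 ^ n * B ^ (t / p) * K ^ (p - t) * (ℓ ^ (p - t) * a)
          + 2 ^ n * (2 : ℝ) ^ (p / t) * b) * (3 * ρ) ^ n) := by gcongr
    _ = 12 ^ n * (4 * B ^ (t / p) * K ^ (p - t)) * (m ^ n * ℓ ^ (p - t) * (ρ ^ n * a)) +
        12 ^ n * (2 : ℝ) ^ (p / t) * (m ^ n * (ρ ^ n * b)) := by
        rw [h12, mul_pow, mul_pow]; ring
    _ = 12 ^ n * (4 * B ^ (t / p) * K ^ (p - t)) * (l ^ (p - t) *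
          (w ^ t * ∫ y in Metric.ball x ρ ∩ {y | ℓ < φ y}, φ y ^ t)) +
        12 ^ n * (2 : ℝ) ^ (p / t) *
          (m ^ n * ∫ y in Metric.ball x ρ ∩ {y | ℓ < ψ y}, ψ y ^ p) := by
        rw [hlt, ha, hb]
        field_simp
    _ ≤ _ := by gcongr

/-- The level-set inequality for the weighted functions. -/
theorem lintegral_superlevel_le {n : ℕ} (hn : 2 ≤ n) {x₀ : Fin n → ℝ} {r : ℝ} (hr : 0 < r)
    {p t α B K k : ℝ} (ht : 0 < t) (htp : t < p) (hα : 1 / 2 ≤ α) (hα1 : α < 1) (hB : 0 < B)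
    (hK : 1 ≤ K) (hKt : K ^ t = 8 ^ n * (B ^ (t / p) + 1)) (hKp : 8 ^ n ≤ K ^ p)
    (hk₁ : K ^ (p - t) * (1 + 4 * 12 ^ n * B ^ (t / p)) ≤ k) (hk₂ : 12 ^ n * (2 : ℝ) ^ (p / t) ≤ k)
    {φ ψ : (Fin n → ℝ) → ℝ} (hφ : Measurable φ) (hψ : Measurable ψ) (hφ0 : ∀ x, 0 ≤ φ x)
    (hψ0 : ∀ x, 0 ≤ ψ x) (hφp : Integrable fun x => φ x ^ p) (hφt : Integrable fun x => φ x ^ t)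
    (hψp : Integrable fun x => ψ x ^ p)
    (hRH : ∀ z ∈ Metric.ball x₀ r, ∀ R : ℝ, 0 < R → √(n : ℝ) * R < r - dist z x₀ →
      1 / R ^ n * ∫ x in Metric.ball z (α * R), φ x ^ p ≤
        B * (1 / R ^ n * ∫ x in Metric.ball z R, φ x ^ t) ^ (p / t)
          + 1 / R ^ n * ∫ x in Metric.ball z R, ψ x ^ p)
    {f g : (Fin n → ℝ) → ℝ} (hf : ∀ x, f x = φ x * weight x₀ r x ^ ((n : ℝ) / p))
    (hg : ∀ x, g x = ψ x * weight x₀ r x ^ ((n : ℝ) / p))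
    (hfm : Measurable f) (hgm : Measurable g) (hf0 : ∀ x, 0 ≤ f x) (hg0 : ∀ x, 0 ≤ g x)
    (hfp : Integrable fun x => f x ^ p) (hft : Integrable fun x => f x ^ t)
    (hgp : Integrable fun x => g x ^ p) {l : ℝ} (hl : 0 < l)
    (hlarge : (18 * n) ^ n * ∫ x, φ x ^ p ≤ 8 ^ n * l ^ p * r ^ n) :
    ∫⁻ x in {x | l < f x}, ENNReal.ofReal (f x ^ p) ≤
      ENNReal.ofReal k * (ENNReal.ofReal (l ^ (p - t)) *
          (∫⁻ x in {x | l < f x}, ENNReal.ofReal (f x ^ t)) +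
        ∫⁻ x in {x | l < g x}, ENNReal.ofReal (g x ^ p)) := by
  have hK0 : 0 < K := by linarith
  have hp : 0 < p := ht.trans htp
  have hfp0 : ∀ x, 0 ≤ f x ^ p := fun x => Real.rpow_nonneg (hf0 x) _
  have hft0 : ∀ x, 0 ≤ f x ^ t := fun x => Real.rpow_nonneg (hf0 x) _
  have hgp0 : ∀ x, 0 ≤ g x ^ p := fun x => Real.rpow_nonneg (hg0 x) _
  have hmf : ∀ c : ℝ, MeasurableSet {x | c < f x} := fun c => measurableSet_lt measurable_const hfm
  have hmg : MeasurableSet {x | l < g x} := measurableSet_lt measurable_const hgm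
  have lint : ∀ {F : (Fin n → ℝ) → ℝ} {ν : Measure (Fin n → ℝ)}, Integrable F ν →
      (∀ x, 0 ≤ F x) → ∫⁻ x, ENNReal.ofReal (F x) ∂ν = ENNReal.ofReal (∫ x, F x ∂ν) :=
    fun h h' => (ofReal_integral_eq_lintegral_ofReal h (Filter.Eventually.of_forall h')).symm
  set c₁ := 12 ^ n * (4 * B ^ (t / p) * K ^ (p - t)) with hc₁
  set c₂ := 12 ^ n * (2 : ℝ) ^ (p / t) with hc₂
  have hc₁0 : 0 ≤ c₁ := by positivity
  have hc₂0 : 0 ≤ c₂ := by positivity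
  set I := ∫⁻ x in {x | l < f x}, ENNReal.ofReal (f x ^ t) with hI
  set J := ∫⁻ x in {x | l < g x}, ENNReal.ofReal (g x ^ p) with hJ
  set μ := (volume : Measure (Fin n → ℝ)).withDensity fun x => ENNReal.ofReal (f x ^ p) with hμ
  set ν₁ := ((volume : Measure (Fin n → ℝ)).restrict {x | l < f x}).withDensity
    fun x => ENNReal.ofReal (f x ^ t) with hν₁
  set ν₂ := ((volume : Measure (Fin n → ℝ)).restrict {x | l < g x}).withDensity
    fun x => ENNReal.ofReal (g x ^ p) with hν₂
  set A := {x : Fin n → ℝ | ∀ c < φ x ^ p, ∀ R₁ : ℝ, 0 < R₁ →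
      ∃ R : ℝ, 0 < R ∧ R ≤ R₁ ∧ c * (2 * R) ^ n < ∫ y in Metric.ball x R, φ y ^ p} with hA
  have hAae : ∀ᵐ x, x ∈ A :=
    ae_exists_ball_integral_gt (by omega) hφp.locallyIntegrable
  have hcover : μ ({x | K * l < f x} ∩ A) ≤
      (ENNReal.ofReal (c₁ * l ^ (p - t)) • ν₁ + ENNReal.ofReal c₂ • ν₂) Set.univ := by
    refine measure_le_of_forall_exists_ball _ _ _ r fun x hx => ?_
    obtain ⟨ρ, hρ0, hρr, hρ⟩ := exists_ball_setIntegral_le hn hr ht htp hα hα1 hB hK0 hKt hKp hφ hψ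
      hφ0 hψ0 hφp hφt hψp hRH hf hg hfm hgm hf0 hg0 hfp hft hgp hl hlarge hx.1 hx.2
    refine ⟨ρ, hρ0, hρr, ?_⟩
    rw [hμ, withDensity_apply _ measurableSet_ball, Measure.add_apply, Measure.smul_apply,
      Measure.smul_apply, hν₁, hν₂, withDensity_apply _ measurableSet_ball,
      withDensity_apply _ measurableSet_ball, Measure.restrict_restrict measurableSet_ball,
      Measure.restrict_restrict measurableSet_ball, lint hfp.integrableOn hfp0,
      lint hft.integrableOn hft0, lint hgp.integrableOn hgp0, smul_eq_mul, smul_eq_mul,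
      ← ENNReal.ofReal_mul (by positivity), ← ENNReal.ofReal_mul (by positivity),
      ← ENNReal.ofReal_add
        (mul_nonneg (by positivity) (integral_nonneg hft0))
        (mul_nonneg (by positivity) (integral_nonneg hgp0))]
    refine ENNReal.ofReal_le_ofReal (hρ.trans_eq ?_)
    ring
  have hhigh : ∫⁻ x in {x | K * l < f x}, ENNReal.ofReal (f x ^ p) ≤
      ENNReal.ofReal (c₁ * l ^ (p - t)) * I + ENNReal.ofReal c₂ * J := by
    -- The points without the differentiation property are null for `volume`, hence for `μ`.
    have h1 : μ ({x | K * l < f x} ∩ A) = ∫⁻ x in {x | K * l < f x}, ENNReal.ofReal (f x ^ p) := by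
      rw [← withDensity_apply _ (hmf _)]
      refine measure_congr ?_
      have hac : μ ≪ volume := withDensity_absolutelyContinuous _ _
      filter_upwards [hac.ae_le hAae] with x hx
      exact propext ⟨fun h => h.1, fun h => ⟨h, hx⟩⟩
    rw [← h1]
    refine hcover.trans_eq ?_
    rw [Measure.add_apply, Measure.smul_apply, Measure.smul_apply, hν₁, hν₂,
      withDensity_apply _ MeasurableSet.univ, withDensity_apply _ MeasurableSet.univ,
      Measure.restrict_univ, Measure.restrict_univ, smul_eq_mul, smul_eq_mul]
  have hlow : ∫⁻ x in {x | l < f x} \ {x | K * l < f x}, ENNReal.ofReal (f x ^ p) ≤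
      ENNReal.ofReal (K ^ (p - t) * l ^ (p - t)) * I := by
    rw [hI, ← lintegral_const_mul' _ _ ENNReal.ofReal_ne_top]
    refine (setLIntegral_mono' ((hmf _).diff (hmf _)) fun x hx => ?_).trans
      (lintegral_mono_set Set.sdiff_subset)
    have hx0 : 0 < f x := hl.trans hx.1
    have hxK : f x ≤ K * l := not_lt.1 hx.2
    rw [← ENNReal.ofReal_mul (by positivity), ← Real.mul_rpow hK0.le hl.le]
    refine ENNReal.ofReal_le_ofReal ?_
    calc f x ^ p = f x ^ (p - t) * f x ^ t := by rw [← Real.rpow_add hx0]; ring_nf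
      _ ≤ _ := mul_le_mul_of_nonneg_right
        (Real.rpow_le_rpow hx0.le hxK (by linarith)) (hft0 x)
  have hsplit : {x | l < f x} = {x | K * l < f x} ∪ ({x | l < f x} \ {x | K * l < f x}) := by
    refine (Set.union_sdiff_cancel fun x (hx : K * l < f x) => ?_).symm
    have : l ≤ K * l := by nlinarith
    exact this.trans_lt hx
  calc ∫⁻ x in {x | l < f x}, ENNReal.ofReal (f x ^ p)
      ≤ (∫⁻ x in {x | K * l < f x}, ENNReal.ofReal (f x ^ p)) +
        ∫⁻ x in {x | l < f x} \ {x | K * l < f x}, ENNReal.ofReal (f x ^ p) := by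
        conv_lhs => rw [hsplit]
        exact lintegral_union_le _ _ _
    _ ≤ (ENNReal.ofReal (c₁ * l ^ (p - t)) * I + ENNReal.ofReal c₂ * J) +
        ENNReal.ofReal (K ^ (p - t) * l ^ (p - t)) * I := add_le_add hhigh hlow
    _ = ENNReal.ofReal ((c₁ + K ^ (p - t)) * l ^ (p - t)) * I + ENNReal.ofReal c₂ * J := by
        rw [add_mul c₁, ENNReal.ofReal_add (by positivity) (by positivity)]
        ring
    _ ≤ ENNReal.ofReal (k * l ^ (p - t)) * I + ENNReal.ofReal k * J := by
        have : c₁ + K ^ (p - t) ≤ k := by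
          rw [hc₁]; linarith
        gcongr
    _ = _ := by
        have hk0 : 0 ≤ k := hc₂0.trans hk₂
        rw [ENNReal.ofReal_mul hk0, mul_add, mul_assoc]

/-! ### The constants -/

/-- Subadditivity of the power `s' / s ≤ 1`. This is what allows any `s ≥ p / t` in place of `p /
t`. -/
theorem rpow_add_one_le_of_le {B s s' : ℝ} (hB : 0 < B) (hs' : 0 < s') (hss : s' ≤ s) :
    (B ^ (1 / s') + 1) ^ s' ≤ (B ^ (1 / s) + 1) ^ s := by
  have hs : 0 < s := hs'.trans_le hss
  have h1 : (B ^ (1 / s') + 1) ^ (s' / s) ≤ B ^ (1 / s) + 1 := by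
    refine (Real.rpow_add_le_add_rpow (by positivity) zero_le_one (by positivity)
      ((div_le_one hs).2 hss)).trans_eq ?_
    rw [← Real.rpow_mul hB.le, Real.one_rpow]
    congr 2
    field_simp
  calc (B ^ (1 / s') + 1) ^ s' = ((B ^ (1 / s') + 1) ^ (s' / s)) ^ s := by
        rw [← Real.rpow_mul (by positivity), div_mul_cancel₀ _ hs.ne']
    _ ≤ _ := Real.rpow_le_rpow (by positivity) h1 hs.le

/-- The left side is `(8 ^ n + 1) * K ^ p` for the `K` of the stopping-time argument, so it is the
quantity `kappa` majorises at `s = p / t`. -/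
theorem le_kappa {n : ℕ} {p t B s : ℝ} (ht : 0 < t) (htp : t < p) (hB : 0 < B) (hs : p / t ≤ s) :
    (8 ^ n + 1) * (8 ^ n * (B ^ (t / p) + 1)) ^ (p / t) ≤ kappa n s B := by
  have hp : 0 < p := ht.trans htp
  have hpt : 0 < p / t := by positivity
  have h1 : ((8 : ℝ) ^ n) ^ (p / t) ≤ (2 : ℝ) ^ (3 * (n : ℝ) * s) := by
    have h8 : (8 : ℝ) ^ n = (2 : ℝ) ^ (3 * (n : ℝ)) := by
      rw [Real.rpow_mul zero_le_two, Real.rpow_natCast]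
      norm_num
    rw [h8, ← Real.rpow_mul zero_le_two]
    exact Real.rpow_le_rpow_of_exponent_le one_le_two (by gcongr)
  have h2 := rpow_add_one_le_of_le hB hpt hs
  rw [one_div_div] at h2
  rw [kappa, Real.mul_rpow (by positivity) (by positivity), ← mul_assoc]
  gcongr

theorem twelve_mul_sq_le {n : ℕ} (hn : 2 ≤ n) : 12 * (n : ℝ) ^ 2 + 1 ≤ 64 ^ n := by
  have h1 : (n : ℝ) ≤ 2 ^ n := by exact_mod_cast Nat.lt_two_pow_self.le
  have h2 : (n : ℝ) ^ 2 ≤ 4 ^ n := by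
    calc (n : ℝ) ^ 2 ≤ (2 ^ n) ^ 2 := by gcongr
      _ = 4 ^ n := by rw [← pow_mul, mul_comm, pow_mul]; norm_num
  have h3 : (16 : ℝ) ≤ 16 ^ n := le_self_pow₀ (by norm_num) (by omega)
  have h4 : (64 : ℝ) ^ n = 16 ^ n * 4 ^ n := by rw [← mul_pow]; norm_num
  have h5 : (1 : ℝ) ≤ 4 ^ n := one_le_pow₀ (by norm_num)
  rw [h4]
  nlinarith

/-- The constants produced by the covering argument are at most half of `kappa`. -/
theorem exists_level_constants {n : ℕ} (hn : 2 ≤ n) {p t B s : ℝ} (ht : 0 < t) (htp : t < p)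
    (hB : 0 < B) (hs : p / t ≤ s) :
    ∃ K : ℝ, 1 ≤ K ∧ K ^ t = 8 ^ n * (B ^ (t / p) + 1) ∧ 8 ^ n ≤ K ^ p ∧
      K ^ (p - t) * (1 + 4 * 12 ^ n * B ^ (t / p)) ≤ kappa n s B / 2 ∧
      12 ^ n * (2 : ℝ) ^ (p / t) ≤ kappa n s B / 2 ∧ 64 ^ n ≤ kappa n s B := by
  have hp : 0 < p := ht.trans htp
  have hpt : 1 ≤ p / t := (one_le_div ht).2 htp.le
  set b := B ^ (t / p) with hb
  have hb0 : 0 < b := by positivity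
  set X := 8 ^ n * (b + 1) with hX
  have h8 : (1 : ℝ) ≤ 8 ^ n := one_le_pow₀ (by norm_num)
  have hX8 : 8 ^ n ≤ X := by
    rw [hX]; exact le_mul_of_one_le_right (by positivity) (by linarith)
  have hX1 : 1 ≤ X := h8.trans hX8
  have hX0 : 0 < X := by linarith
  set K := X ^ (1 / t) with hK
  have hK1 : 1 ≤ K := Real.one_le_rpow hX1 (by positivity)
  have hK0 : 0 < K := by linarith
  have hKt : K ^ t = X := by
    rw [hK, ← Real.rpow_mul hX0.le, one_div_mul_cancel ht.ne', Real.rpow_one]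
  have hKp : K ^ p = X ^ (p / t) := by
    rw [hK, ← Real.rpow_mul hX0.le, one_div_mul_eq_div]
  have hκ : (8 ^ n + 1) * K ^ p ≤ kappa n s B := by
    rw [hKp]; exact le_kappa ht htp hB hs
  have hKp8 : 8 ^ n ≤ K ^ p := by
    rw [hKp]; exact hX8.trans (Real.self_le_rpow_of_one_le hX1 hpt)
  have h64 : (64 : ℝ) ^ n = 8 ^ n * 8 ^ n := by rw [← mul_pow]; norm_num
  refine ⟨K, hK1, hKt, hKp8, ?_, ?_, ?_⟩
  · have h1 : K ^ p = K ^ (p - t) * X := by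
      rw [← hKt, ← Real.rpow_add hK0]; ring_nf
    have h2 : 8 * (12 : ℝ) ^ n ≤ 64 ^ n := by
      have e1 : (64 : ℝ) ^ n = 4 ^ n * 16 ^ n := by rw [← mul_pow]; norm_num
      have e2 : (12 : ℝ) ^ n ≤ 16 ^ n := pow_le_pow_left₀ (by norm_num) (by norm_num) n
      have e3 : (4 : ℝ) ^ 2 ≤ 4 ^ n := pow_le_pow_right₀ (by norm_num) hn
      rw [e1]
      have : (0 : ℝ) < 12 ^ n := by positivity
      nlinarith
    have h3 : (1 : ℝ) ≤ 12 ^ n := one_le_pow₀ (by norm_num)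
    have h4 : 2 * (1 + 4 * 12 ^ n * b) ≤ 64 ^ n * (b + 1) := by nlinarith
    have h5 : 64 ^ n * (b + 1) ≤ (8 ^ n + 1) * X := by
      rw [h64, hX, mul_assoc]
      gcongr
      linarith
    have h6 : K ^ (p - t) * (2 * (1 + 4 * 12 ^ n * b)) ≤ K ^ (p - t) * ((8 ^ n + 1) * X) :=
      mul_le_mul_of_nonneg_left (h4.trans h5) (by positivity)
    rw [h1] at hκ
    linarith
  · have h1 : (4 : ℝ) ^ n * 2 ^ (p / t) ≤ K ^ p := by
      rw [hKp]
      calc (4 : ℝ) ^ n * 2 ^ (p / t) ≤ (4 ^ n) ^ (p / t) * (2 ^ n) ^ (p / t) := by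
            gcongr
            · exact Real.self_le_rpow_of_one_le (one_le_pow₀ (by norm_num)) hpt
            · exact le_self_pow₀ one_le_two (by omega)
        _ = (8 ^ n) ^ (p / t) := by
            rw [← Real.mul_rpow (by positivity) (by positivity), ← mul_pow]; norm_num
        _ ≤ X ^ (p / t) := by gcongr
    have h2 : 2 * (12 : ℝ) ^ n ≤ 8 ^ n * 4 ^ n := by
      have e1 : (8 : ℝ) ^ n * 4 ^ n = 2 ^ n * 16 ^ n := by
        rw [← mul_pow, ← mul_pow]; norm_num
      have e2 : (12 : ℝ) ^ n ≤ 16 ^ n := pow_le_pow_left₀ (by norm_num) (by norm_num) n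
      have e3 : (2 : ℝ) ≤ 2 ^ n := le_self_pow₀ one_le_two (by omega)
      rw [e1]
      gcongr
    have h3 : 2 * (12 ^ n * (2 : ℝ) ^ (p / t)) ≤ kappa n s B := by
      calc 2 * (12 ^ n * (2 : ℝ) ^ (p / t)) = 2 * 12 ^ n * (2 : ℝ) ^ (p / t) := by ring
        _ ≤ 8 ^ n * 4 ^ n * (2 : ℝ) ^ (p / t) := by gcongr
        _ = 8 ^ n * (4 ^ n * (2 : ℝ) ^ (p / t)) := by ring
        _ ≤ (8 ^ n + 1) * K ^ p := by gcongr; linarith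
        _ ≤ _ := hκ
    linarith
  · rw [h64]
    refine le_trans ?_ hκ
    gcongr
    linarith

/-- The factor lost by starting the stopping-time argument at a small scale is absorbed by
replacing `κ / 2` by `κ`. -/
theorem rpow_mul_le_sub {n : ℕ} (hn : 2 ≤ n) {p q t κ : ℝ} (ht : 0 < t) (htp : t < p)
    (hpq : p ≤ q) (hκ : 64 ^ n ≤ κ) (hD : 0 < q - t - κ * (q - p)) :
    (((18 * n) ^ n / 8 ^ n : ℝ) ^ ((q - p) / p)) * (q - t - κ * (q - p)) ≤
      q - t - κ / 2 * (q - p) := by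
  have hp : 0 < p := ht.trans htp
  have hn0 : (0 : ℝ) < n := by exact_mod_cast (by omega : 0 < n)
  have h12 := twelve_mul_sq_le hn
  set y := (q - p) / p with hy
  have hy0 : 0 ≤ y := div_nonneg (by linarith) hp.le
  have hyp : y * p = q - p := by rw [hy]; field_simp
  have hbase : ((18 * n) ^ n / 8 ^ n : ℝ) = Real.exp (n * Real.log (9 / 4 * n)) := by
    rw [← Real.rpow_natCast, ← Real.rpow_natCast, ← Real.div_rpow (by positivity) (by positivity),
      Real.rpow_def_of_pos (by positivity), mul_comm (Real.log _)]
    congr 3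
    ring
  set z := 3 * (n : ℝ) ^ 2 * y with hz
  have hz0 : 0 ≤ z := by positivity
  -- The base is `(9 / 4 * n) ^ n`, whose logarithm is at most `9 / 4 * n ^ 2 ≤ 3 * n ^ 2`.
  have hE : ((18 * n) ^ n / 8 ^ n : ℝ) ^ y ≤ Real.exp z := by
    rw [hbase, ← Real.exp_mul]
    refine Real.exp_le_exp.2 ?_
    rw [hz]
    refine mul_le_mul_of_nonneg_right ?_ hy0
    have hlog : Real.log (9 / 4 * n) ≤ 9 / 4 * n := Real.log_le_self (by positivity)
    have : (n : ℝ) * Real.log (9 / 4 * n) ≤ n * (9 / 4 * n) := by gcongr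
    nlinarith [sq_nonneg (n : ℝ)]
  have hκ1 : 12 * (n : ℝ) ^ 2 ≤ κ - 1 := by linarith
  have hκ0 : 0 ≤ κ - 1 := le_trans (by positivity) hκ1
  -- Positivity of `D` says `(κ - 1) * (q - p) < p - t`. With `κ - 1 ≥ 12 * n ^ 2` this keeps `z` in
  -- the range where `exp z ≤ 1 + 2 * z`.
  have hκy : (κ - 1) * y ≤ 1 := by
    have h1 : (κ - 1) * y * p < p := by rw [mul_assoc, hyp]; linarith
    exact (lt_of_mul_lt_mul_right (h1.trans_eq (one_mul p).symm) hp.le).le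
  have h12y : 12 * (n : ℝ) ^ 2 * y ≤ (κ - 1) * y := by gcongr
  have hz1 : z ≤ 1 := by rw [hz]; nlinarith
  have hexp : Real.exp z ≤ 1 + 2 * z := by
    have := (abs_le.1 (Real.abs_exp_sub_one_sub_id_le (x := z) (by rwa [abs_of_nonneg hz0]))).2
    nlinarith
  set D := q - t - κ * (q - p) with hDdef
  have hDp : D ≤ p := by
    have : 0 ≤ (κ - 1) * (q - p) := mul_nonneg hκ0 (by linarith)
    rw [hDdef]; linarith
  calc ((18 * n) ^ n / 8 ^ n : ℝ) ^ y * D ≤ (1 + 2 * z) * D := by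
        gcongr
        exact hE.trans hexp
    _ = D + 2 * z * D := by ring
    _ ≤ D + 2 * z * p := by gcongr
    _ ≤ D + κ / 2 * (y * p) := by
        have h1 : 2 * z ≤ κ / 2 * y := by rw [hz]; nlinarith
        have := mul_le_mul_of_nonneg_right h1 hp.le
        linarith
    _ = _ := by rw [hyp, hDdef]; ring

/-! ### Gehring's lemma in the sup norm -/

/-- Jensen's inequality for the power `q / p` on a ball of volume `(2 * r) ^ n`. -/
theorem rpow_integral_ball_le {n : ℕ} {x₀ : Fin n → ℝ} {r : ℝ} (hr : 0 < r) {p q : ℝ} (hp : 0 < p)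
    (hpq : p ≤ q) {ψ : (Fin n → ℝ) → ℝ} (hψ0 : ∀ x, 0 ≤ ψ x)
    (hψp : Integrable fun x => ψ x ^ p) (hψq : Integrable fun x => ψ x ^ q) :
    (∫ x in Metric.ball x₀ r, ψ x ^ p) ^ (q / p) ≤
      ((2 * r) ^ n) ^ ((q - p) / p) * ∫ x in Metric.ball x₀ r, ψ x ^ q := by
  have hv : volume.real (Metric.ball x₀ r) = (2 * r) ^ n := by
    rw [Measure.real, Real.volume_pi_ball x₀ hr, ENNReal.toReal_ofReal (by positivity)]
    simp
  set V := (2 * r) ^ n with hV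
  have hV0 : 0 < V := by positivity
  have hpow : ∀ x, (ψ x ^ p) ^ (q / p) = ψ x ^ q := fun x => by
    rw [← Real.rpow_mul (hψ0 x), mul_div_cancel₀ _ hp.ne']
  have hqp : 1 ≤ q / p := (one_le_div hp).2 hpq
  have h := (convexOn_rpow hqp).map_set_average_le (μ := volume) (t := Metric.ball x₀ r)
    (f := fun x => ψ x ^ p)
    (continuousOn_id.rpow_const fun x _ => Or.inr (by linarith)) isClosed_Ici
    (Metric.measure_ball_pos volume x₀ hr).ne' measure_ball_lt_top.ne
    (Filter.Eventually.of_forall fun x => Real.rpow_nonneg (hψ0 x) _) hψp.integrableOn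
    (by simpa only [Function.comp_def, hpow] using hψq.integrableOn)
  simp only [setAverage_eq, hv, smul_eq_mul, hpow] at h
  have hI : 0 ≤ ∫ x in Metric.ball x₀ r, ψ x ^ p :=
    integral_nonneg fun x => Real.rpow_nonneg (hψ0 x) _
  rw [Real.mul_rpow (by positivity) hI, Real.inv_rpow hV0.le, inv_mul_le_iff₀ (by positivity),
    ← mul_assoc] at h
  refine h.trans_eq ?_
  congr 1
  rw [sub_div, div_self hp.ne', Real.rpow_sub hV0, Real.rpow_one]
  rfl

theorem add_rpow_le_two_rpow_mul {a b e : ℝ} (ha : 0 ≤ a) (hb : 0 ≤ b) (he : 1 ≤ e) :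
    (a + b) ^ e ≤ 2 ^ (e - 1) * (a ^ e + b ^ e) := by
  lift a to NNReal using ha
  lift b to NNReal using hb
  exact_mod_cast NNReal.rpow_add_le_mul_rpow_add_rpow a b he

theorem sub_kappa_pos {p q t κ : ℝ} (hκ : 1 < κ) (hq : q < p + (p - t) / (κ - 1)) :
    0 < q - t - κ * (q - p) := by
  have h1 : q - p < (p - t) / (κ - 1) := by linarith
  rw [lt_div_iff₀ (by linarith)] at h1
  linarith

/-- Gehring's lemma on a ball of the sup norm, for functions on `Fin n → ℝ`. -/
theorem integral_weighted_rpow_le {n : ℕ} (hn : 2 ≤ n) {x₀ : Fin n → ℝ} {r : ℝ} (hr : 0 < r)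
    {p q t α B s : ℝ} (ht : 0 < t) (htp : t < p) (hα : 1 / 2 ≤ α) (hα1 : α < 1) (hB : 0 < B)
    (hs : p / t ≤ s) (hpq : p ≤ q) (hq : q < p + (p - t) / (kappa n s B - 1))
    {φ ψ : (Fin n → ℝ) → ℝ} (hφ : Measurable φ) (hψ : Measurable ψ) (hφ0 : ∀ x, 0 ≤ φ x)
    (hψ0 : ∀ x, 0 ≤ ψ x) (hφp : Integrable fun x => φ x ^ p) (hφt : Integrable fun x => φ x ^ t)
    (hψp : Integrable fun x => ψ x ^ p) (hψq : Integrable fun x => ψ x ^ q)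
    (hψs : ∀ x ∉ Metric.ball x₀ r, ψ x = 0)
    (hRH : ∀ z ∈ Metric.ball x₀ r, ∀ R : ℝ, 0 < R → √(n : ℝ) * R < r - dist z x₀ →
      1 / R ^ n * ∫ x in Metric.ball z (α * R), φ x ^ p ≤
        B * (1 / R ^ n * ∫ x in Metric.ball z R, φ x ^ t) ^ (p / t)
          + 1 / R ^ n * ∫ x in Metric.ball z R, ψ x ^ p) :
    Integrable (fun x => (φ x * weight x₀ r x ^ ((n : ℝ) / p)) ^ q) ∧
    ∫ x, (φ x * weight x₀ r x ^ ((n : ℝ) / p)) ^ q ≤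
      1 / (q - t - kappa n s B * (q - p)) *
        ((p - t) * r ^ (-(n * (q - p) / p)) * (2 : ℝ) ^ ((q - p) / p) *
            (∫ x, φ x ^ p) ^ (q / p)
          + ((2 : ℝ) ^ ((n + 1) * (q - p) / p) * (p - t) + kappa n s B * (q - t)) *
            ∫ x, ψ x ^ q) := by
  have hp : 0 < p := ht.trans htp
  have hq0 : 0 < q := by linarith
  obtain ⟨K, hK1, hKt, hKp, hk₁, hk₂, h64⟩ := exists_level_constants hn ht htp hB hs
  set κ := kappa n s B with hκ
  have h12 := twelve_mul_sq_le hn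
  have hκ2 : 2 ≤ κ := by
    have h2 : (2 : ℝ) ≤ n := by exact_mod_cast hn
    nlinarith
  have hD : 0 < q - t - κ * (q - p) := sub_kappa_pos (by linarith) hq
  have hE := rpow_mul_le_sub hn ht htp hpq h64 hD
  set D := q - t - κ * (q - p) with hDdef
  set D' := q - t - κ / 2 * (q - p) with hD'def
  have hDD' : D ≤ D' := by
    have : 0 ≤ κ * (q - p) := mul_nonneg (by linarith) (by linarith)
    rw [hDdef, hD'def]; linarith
  have hD'0 : 0 < D' := hD.trans_le hDD'
  set y := (q - p) / p with hy
  have hy0 : 0 ≤ y := div_nonneg (by linarith) hp.le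
  have hqy : q / p = 1 + y := by rw [hy]; field_simp; ring
  set f : (Fin n → ℝ) → ℝ := fun x => φ x * weight x₀ r x ^ ((n : ℝ) / p) with hf
  set g : (Fin n → ℝ) → ℝ := fun x => ψ x * weight x₀ r x ^ ((n : ℝ) / p) with hg
  have hwm : Measurable fun x => weight x₀ r x ^ ((n : ℝ) / p) :=
    continuous_weight.measurable.pow_const _
  have hw0 : ∀ x, 0 ≤ weight x₀ r x ^ ((n : ℝ) / p) := fun x =>
    Real.rpow_nonneg (weight_nonneg x) _
  have hw1 : ∀ x, weight x₀ r x ^ ((n : ℝ) / p) ≤ 1 := fun x =>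
    Real.rpow_le_one (weight_nonneg x) (weight_le_one hr x) (by positivity)
  have hfm : Measurable f := hφ.mul hwm
  have hgm : Measurable g := hψ.mul hwm
  have hf0 : ∀ x, 0 ≤ f x := fun x => mul_nonneg (hφ0 x) (hw0 x)
  have hg0 : ∀ x, 0 ≤ g x := fun x => mul_nonneg (hψ0 x) (hw0 x)
  have hfφ : ∀ x, f x ≤ φ x := fun x => mul_le_of_le_one_right (hφ0 x) (hw1 x)
  have hgψ : ∀ x, g x ≤ ψ x := fun x => mul_le_of_le_one_right (hψ0 x) (hw1 x)
  have hdom : ∀ {h k : (Fin n → ℝ) → ℝ} {e : ℝ}, 0 < e → Measurable h → (∀ x, 0 ≤ h x) →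
      (∀ x, h x ≤ k x) → (Integrable fun x => k x ^ e) → Integrable fun x => h x ^ e := by
    intro h k e he hh hh0 hhk hk
    refine hk.mono' (hh.pow_const _).aestronglyMeasurable (Filter.Eventually.of_forall fun x => ?_)
    rw [Real.norm_of_nonneg (Real.rpow_nonneg (hh0 x) _)]
    exact Real.rpow_le_rpow (hh0 x) (hhk x) he.le
  have hfp := hdom hp hfm hf0 hfφ hφp
  have hft := hdom ht hfm hf0 hfφ hφt
  have hgp := hdom hp hgm hg0 hgψ hψp
  have hgq := hdom hq0 hgm hg0 hgψ hψq
  set P := ∫ x, φ x ^ p with hP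
  set P' := ∫ x, ψ x ^ p with hP'
  set Y := ∫ x, ψ x ^ q with hY
  have hP0 : 0 ≤ P := integral_nonneg fun x => Real.rpow_nonneg (hφ0 x) _
  have hP'0 : 0 ≤ P' := integral_nonneg fun x => Real.rpow_nonneg (hψ0 x) _
  have hY0 : 0 ≤ Y := integral_nonneg fun x => Real.rpow_nonneg (hψ0 x) _
  have hRHS : 0 ≤ (p - t) * r ^ (-(n * (q - p) / p)) * (2 : ℝ) ^ y * P ^ (q / p)
      + ((2 : ℝ) ^ ((n + 1) * (q - p) / p) * (p - t) + κ * (q - t)) * Y := by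
    have h1 : 0 ≤ p - t := by linarith
    have h2 : 0 ≤ q - t := by linarith
    positivity
  -- The starting level `a` has to be positive; if `P = 0` then `φ` vanishes almost everywhere.
  rcases hP0.eq_or_lt with hPz | hPpos
  · have hz : ∀ᵐ x, f x ^ q = 0 := by
      have := (integral_eq_zero_iff_of_nonneg (fun x => Real.rpow_nonneg (hφ0 x) p) hφp).1 hPz.symm
      filter_upwards [this] with x hx
      have hx' : φ x = 0 := (Real.rpow_eq_zero (hφ0 x) hp.ne').1 hx
      simp [hf, hx', Real.zero_rpow hq0.ne']
    refine ⟨(integrable_zero _ _ _).congr (hz.mono fun x hx => hx.symm), ?_⟩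
    rw [integral_congr_ae hz, integral_zero]
    positivity
  -- The largeness condition needs only `P ≤ M`; the summand `P'` produces the `(p - t)` part of the
  -- `ψ` term in the stated bound.
  set M := P + P' with hM
  have hM0 : 0 < M := by positivity
  set Λ := (18 * n) ^ n / 8 ^ n * (M / r ^ n) with hΛ
  have hn0 : (0 : ℝ) < n := by exact_mod_cast (by omega : 0 < n)
  have hΛ0 : 0 < Λ := by positivity
  set a := Λ ^ (1 / p) with ha
  have ha0 : 0 < a := by positivity
  have hap : a ^ p = Λ := by rw [ha, ← Real.rpow_mul hΛ0.le, one_div_mul_cancel hp.ne',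
    Real.rpow_one]
  have haqp : a ^ (q - p) = Λ ^ y := by
    rw [ha, ← Real.rpow_mul hΛ0.le, hy, one_div_mul_eq_div]
  obtain ⟨hint, hmain⟩ := integral_rpow_le_of_level (μ := volume) (k := κ / 2) (a := a) hfm hgm hf0
    hg0 ht htp hpq (by linarith) hD'0 ha0 hfp hft hgp hgq (fun l hl => by
      have hl0 : 0 < l := ha0.trans_le hl
      refine lintegral_superlevel_le hn hr ht htp hα hα1 hB hK1 hKt hKp hk₁ hk₂ hφ hψ hφ0 hψ0 hφp
        hφt hψp hRH (fun _ => rfl) (fun _ => rfl) hfm hgm hf0 hg0 hfp hft hgp hl0 ?_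
      have h1 : Λ ≤ l ^ p := by rw [← hap]; gcongr
      calc (18 * n) ^ n * P ≤ (18 * n) ^ n * M := by
            gcongr; rw [hM]; linarith
        _ = 8 ^ n * Λ * r ^ n := by rw [hΛ]; field_simp
        _ ≤ 8 ^ n * l ^ p * r ^ n := by gcongr)
  refine ⟨hint, ?_⟩
  set F := ∫ x, f x ^ q with hF
  have hfP : ∫ x, f x ^ p ≤ P := integral_mono hfp hφp fun x =>
    Real.rpow_le_rpow (hf0 x) (hfφ x) hp.le
  have hgY : ∫ x, g x ^ q ≤ Y := integral_mono hgq hψq fun x =>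
    Real.rpow_le_rpow (hg0 x) (hgψ x) hq0.le
  set E := ((18 * n) ^ n / 8 ^ n : ℝ) ^ y with hEdef
  set V := (M / r ^ n) ^ y * M with hV
  have hV0 : 0 ≤ V := by positivity
  have hΛy : Λ ^ y * P ≤ E * V := by
    rw [hΛ, Real.mul_rpow (by positivity) (by positivity), hV, mul_assoc]
    gcongr
    rw [hM]; linarith
  have hptn : 0 ≤ p - t := by linarith
  have hqtn : 0 ≤ q - t := by linarith
  -- The level argument with `κ / 2` bounds `D' * F`, with an excess factor `E` on the first term.
  -- Multiplying by `D` and using `E * D ≤ D'` trades `E` for the passage from `D'` to `D`.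
  have hDF : D * F ≤ (p - t) * V + κ * (q - t) * Y := by
    refine le_of_mul_le_mul_left ?_ hD'0
    calc D' * (D * F) = D * (D' * F) := by ring
      _ ≤ D * ((p - t) * a ^ (q - p) * (∫ x, f x ^ p) + κ / 2 * (q - t) * ∫ x, g x ^ q) := by
          gcongr
      _ ≤ D * ((p - t) * Λ ^ y * P + κ / 2 * (q - t) * Y) := by rw [haqp]; gcongr
      _ = D * (p - t) * (Λ ^ y * P) + D * (κ / 2 * (q - t) * Y) := by ring
      _ ≤ D * (p - t) * (E * V) + D' * (κ * (q - t) * Y) := by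
          gcongr
          linarith
      _ = (E * D) * ((p - t) * V) + D' * (κ * (q - t) * Y) := by ring
      _ ≤ D' * ((p - t) * V) + D' * (κ * (q - t) * Y) := by gcongr
      _ = _ := by ring
  have hVle : V ≤ r ^ (-(n * (q - p) / p)) * (2 : ℝ) ^ y * P ^ (q / p) +
      (2 : ℝ) ^ ((n + 1) * (q - p) / p) * Y := by
    have hPY : P' ^ (q / p) ≤ ((2 * r) ^ n) ^ y * Y := by
      have h := rpow_integral_ball_le (x₀ := x₀) hr hp hpq hψ0 hψp hψq
      rw [setIntegral_eq_integral_of_forall_compl_eq_zero fun x hx => by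
          rw [hψs x hx, Real.zero_rpow hp.ne'],
        setIntegral_eq_integral_of_forall_compl_eq_zero fun x hx => by
          rw [hψs x hx, Real.zero_rpow hq0.ne']] at h
      exact h
    have hrn : (r ^ n) ^ y = r ^ (n * y) := by
      rw [← Real.rpow_natCast, ← Real.rpow_mul hr.le]
    have hneg : r ^ (-(n * (q - p) / p)) = (r ^ (n * y))⁻¹ := by
      rw [Real.rpow_neg hr.le, hy, mul_div_assoc]
    have h2 : (2 : ℝ) ^ ((n + 1) * (q - p) / p) = 2 ^ y * 2 ^ (n * y) := by
      rw [← Real.rpow_add two_pos, hy]; congr 1; ring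
    have hMM : M ^ y * M = M ^ (q / p) := by
      rw [hqy, Real.rpow_add hM0, Real.rpow_one, mul_comm]
    have h2r : ((2 * r) ^ n) ^ y = 2 ^ (n * y) * r ^ (n * y) := by
      rw [mul_pow, Real.mul_rpow (by positivity) (by positivity), hrn, ← Real.rpow_natCast,
        ← Real.rpow_mul zero_le_two]
    have hadd := add_rpow_le_two_rpow_mul hP0 hP'0 ((one_le_div hp).2 hpq)
    have hq1 : q / p - 1 = y := by rw [hqy]; ring
    rw [hq1] at hadd
    have hrpos : 0 < r ^ (n * y) := by positivity
    rw [hV, Real.div_rpow hM0.le (by positivity), hrn, hneg, h2, div_mul_eq_mul_div, hMM,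
      div_le_iff₀ hrpos]
    calc M ^ (q / p) ≤ 2 ^ y * (P ^ (q / p) + P' ^ (q / p)) := hadd
      _ ≤ 2 ^ y * (P ^ (q / p) + 2 ^ (n * y) * r ^ (n * y) * Y) := by
          rw [← h2r]; gcongr
      _ = _ := by field_simp
  rw [one_div, ← div_eq_inv_mul, le_div_iff₀ hD, mul_comm]
  have := mul_le_mul_of_nonneg_left hVle hptn
  linarith

/-! ### Transfer between Euclidean space and the sup norm -/

section transfer

variable {n : ℕ}

theorem cube_eq_preimage (x : EuclideanSpace ℝ (Fin n)) {R : ℝ} (hR : 0 < R) :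
    cube x R = WithLp.ofLp ⁻¹' Metric.ball (WithLp.ofLp x) R := by
  ext y
  simp [cube, dist_pi_lt_iff hR, Real.dist_eq]

theorem isOpen_cube (x : EuclideanSpace ℝ (Fin n)) {R : ℝ} (hR : 0 < R) : IsOpen (cube x R) := by
  rw [cube_eq_preimage x hR]
  exact Metric.isOpen_ball.preimage (PiLp.continuous_ofLp 2 _)

theorem measurableEmbedding_ofLp :
    MeasurableEmbedding (WithLp.ofLp : EuclideanSpace ℝ (Fin n) → Fin n → ℝ) :=
  (MeasurableEquiv.toLp 2 (Fin n → ℝ)).symm.measurableEmbedding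

/-- A frontier point lies outside the open cube, hence at sup distance at least `R` from its centre,
and the sup distance is at most the Euclidean one. -/
theorem dist_ofLp_le_infDist_frontier (hn : 1 ≤ n) (x z : EuclideanSpace ℝ (Fin n)) {R : ℝ}
    (hR : 0 < R) :
    R - dist (WithLp.ofLp z) (WithLp.ofLp x) ≤ Metric.infDist z (frontier (cube x R)) := by
  have : Nonempty (Fin n) := ⟨⟨0, hn⟩⟩
  have hne : (frontier (cube x R)).Nonempty := by
    refine nonempty_frontier_iff.2 ⟨⟨x, fun i => by simpa using hR⟩, fun h => ?_⟩
    have h1 : x + WithLp.toLp 2 (fun _ => R) ∈ cube x R := h ▸ Set.mem_univ _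
    have h2 := h1 ⟨0, hn⟩
    simp [abs_of_pos hR] at h2
  refine (Metric.le_infDist hne).2 fun y hy => ?_
  have hy' : y ∉ cube x R := by
    rw [(isOpen_cube x hR).frontier_eq] at hy
    exact hy.2
  rw [cube_eq_preimage x hR, Set.mem_preimage, Metric.mem_ball, not_lt] at hy'
  have h1 := dist_triangle (WithLp.ofLp y) (WithLp.ofLp z) (WithLp.ofLp x)
  have h2 : dist (WithLp.ofLp y) (WithLp.ofLp z) ≤ dist z y := by
    rw [dist_comm z y]
    refine (dist_pi_le_iff dist_nonneg).2 fun i => ?_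
    rw [dist_eq_norm, dist_eq_norm]
    exact PiLp.norm_apply_le (y - z) i
  linarith

/-- The cube sits in the Euclidean ball of radius `√n * R`, which is connected, meets `Ω` and misses
its frontier. -/
theorem cube_subset_of_lt_infDist {Ω : Set (EuclideanSpace ℝ (Fin n))} (hn : 1 ≤ n)
    {x : EuclideanSpace ℝ (Fin n)} (hx : x ∈ Ω) {R : ℝ} (hR : 0 < R)
    (hd : √(n : ℝ) * R < Metric.infDist x (frontier Ω)) : cube x R ⊆ Ω := by
  have hn1 : (1 : ℝ) ≤ n := by exact_mod_cast hn
  have hball : Metric.ball x (√(n : ℝ) * R) ⊆ Ω := by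
    by_contra hcon
    obtain ⟨y, hy, hyΩ⟩ := Set.not_subset.1 hcon
    have hpc : IsPreconnected (Metric.ball x (√(n : ℝ) * R)) :=
      (convex_ball x _).isPreconnected
    have hxb : x ∈ Metric.ball x (√(n : ℝ) * R) := Metric.mem_ball_self (by positivity)
    have hf : ∀ w ∈ Metric.ball x (√(n : ℝ) * R), w ∉ frontier Ω := fun w hw hwf => by
      have := Metric.infDist_le_dist_of_mem (x := x) hwf
      rw [Metric.mem_ball, dist_comm] at hw
      linarith
    obtain ⟨w, -, hw1, hw2⟩ := hpc (interior Ω) (closure Ω)ᶜ isOpen_interior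
      isClosed_closure.isOpen_compl
      (fun w hw => by
        by_cases h : w ∈ closure Ω
        · exact Or.inl (by_contra fun h' => hf w hw ⟨h, h'⟩)
        · exact Or.inr h)
      ⟨x, hxb, by_contra fun h' => hf x hxb ⟨subset_closure hx, h'⟩⟩
      ⟨y, hy, fun h => hf y hy ⟨h, fun h' => hyΩ (interior_subset h')⟩⟩
    exact hw2 (subset_closure (interior_subset hw1))
  refine Set.Subset.trans (fun y hy => ?_) hball
  rw [Metric.mem_ball, EuclideanSpace.dist_eq]
  have hlt : ∑ i, dist (y i) (x i) ^ 2 < n * R ^ 2 := by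
    have : Nonempty (Fin n) := ⟨⟨0, hn⟩⟩
    calc ∑ i, dist (y i) (x i) ^ 2 < ∑ _i : Fin n, R ^ 2 :=
          Finset.sum_lt_sum_of_nonempty Finset.univ_nonempty fun i _ =>
            pow_lt_pow_left₀ (by rw [Real.dist_eq]; exact hy i) dist_nonneg two_ne_zero
      _ = n * R ^ 2 := by simp
  rw [Real.sqrt_lt' (by positivity), mul_pow, Real.sq_sqrt (by positivity)]
  exact hlt

/-- A function on Euclidean space that is nonnegative on a cube agrees there, almost everywhere,
with a nonnegative measurable function on `Fin n → ℝ` that vanishes off the cube. -/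
theorem exists_measurable_ofLp_representative {Φ : EuclideanSpace ℝ (Fin n) → ℝ}
    {x : EuclideanSpace ℝ (Fin n)} {r : ℝ} (hr : 0 < r)
    (hΦ : AEStronglyMeasurable Φ (volume.restrict (cube x r)))
    (hΦ0 : ∀ᵐ y ∂(volume.restrict (cube x r)), 0 ≤ Φ y) :
    ∃ φ : (Fin n → ℝ) → ℝ, Measurable φ ∧ (∀ y, 0 ≤ φ y) ∧
      (∀ y ∉ Metric.ball (WithLp.ofLp x) r, φ y = 0) ∧
      ∀ᵐ y ∂(volume.restrict (cube x r)), Φ y = φ (WithLp.ofLp y) := by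
  refine ⟨(Metric.ball (WithLp.ofLp x) r).indicator fun y => |hΦ.mk Φ (WithLp.toLp 2 y)|,
    Measurable.indicator ?_ measurableSet_ball, fun y => Set.indicator_nonneg
      (fun _ _ => abs_nonneg _) _, fun y hy => Set.indicator_of_notMem hy _, ?_⟩
  · have h1 : Measurable (hΦ.mk Φ) := hΦ.stronglyMeasurable_mk.measurable
    have h2 : Measurable (WithLp.toLp 2 : (Fin n → ℝ) → EuclideanSpace ℝ (Fin n)) :=
      (MeasurableEquiv.toLp 2 (Fin n → ℝ)).measurable
    exact measurable_norm.comp (h1.comp h2)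
  · filter_upwards [hΦ.ae_eq_mk, hΦ0, ae_restrict_mem (isOpen_cube x hr).measurableSet]
      with y h1 h2 h3
    rw [cube_eq_preimage x hr] at h3
    rw [Set.indicator_of_mem (Set.mem_preimage.1 h3)]
    change Φ y = |hΦ.mk Φ y|
    rw [← h1, abs_of_nonneg h2]

theorem setIntegral_rpow_ofLp {Φ : EuclideanSpace ℝ (Fin n) → ℝ} {φ : (Fin n → ℝ) → ℝ}
    {Q : Set (EuclideanSpace ℝ (Fin n))}
    (hφ : ∀ᵐ y ∂(volume.restrict Q), Φ y = φ (WithLp.ofLp y)) {s : Set (Fin n → ℝ)}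
    (hs : WithLp.ofLp ⁻¹' s ⊆ Q) (e : ℝ) :
    ∫ y in WithLp.ofLp ⁻¹' s, Φ y ^ e = ∫ y in s, φ y ^ e := by
  rw [← (PiLp.volume_preserving_ofLp (Fin n)).setIntegral_preimage_emb measurableEmbedding_ofLp]
  refine integral_congr_ae ?_
  filter_upwards [ae_restrict_of_ae_restrict_of_subset hs hφ] with y hy
  rw [hy]

theorem integrable_rpow_of_memLp {Φ : EuclideanSpace ℝ (Fin n) → ℝ} {φ : (Fin n → ℝ) → ℝ}
    {x : EuclideanSpace ℝ (Fin n)} {r : ℝ} (hr : 0 < r) (hφ0 : ∀ y, 0 ≤ φ y)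
    (hφs : ∀ y ∉ Metric.ball (WithLp.ofLp x) r, φ y = 0)
    (hφ : ∀ᵐ y ∂(volume.restrict (cube x r)), Φ y = φ (WithLp.ofLp y)) {e : ℝ} (he : 0 < e)
    (hΦ : MemLp Φ (ENNReal.ofReal e) (volume.restrict (cube x r))) :
    Integrable fun y => φ y ^ e := by
  have h1 := hΦ.integrable_norm_rpow (by simpa using he) ENNReal.ofReal_ne_top
  rw [ENNReal.toReal_ofReal he.le] at h1
  have h2 : IntegrableOn (fun y => φ (WithLp.ofLp y) ^ e) (cube x r) := by
    refine h1.congr ?_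
    filter_upwards [hφ] with y hy
    rw [hy, Real.norm_of_nonneg (hφ0 _)]
  rw [cube_eq_preimage x hr] at h2
  have h3 : IntegrableOn (fun y => φ y ^ e) (Metric.ball (WithLp.ofLp x) r) :=
    ((PiLp.volume_preserving_ofLp (Fin n)).integrableOn_comp_preimage
      measurableEmbedding_ofLp).1 h2
  refine (integrableOn_iff_integrable_of_support_subset fun y hy => ?_).1 h3
  by_contra hcon
  exact hy (by simp only [hφs y hcon, Real.zero_rpow he.ne'])

theorem lpNorm_rpow_eq_setIntegral {Φ : EuclideanSpace ℝ (Fin n) → ℝ} {φ : (Fin n → ℝ) → ℝ}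
    {x : EuclideanSpace ℝ (Fin n)} {r ρ : ℝ} (hρ : 0 < ρ) (hρr : ρ ≤ r) (hφ0 : ∀ y, 0 ≤ φ y)
    (hΦ : AEStronglyMeasurable Φ (volume.restrict (cube x r)))
    (hφ : ∀ᵐ y ∂(volume.restrict (cube x r)), Φ y = φ (WithLp.ofLp y)) {e : ℝ} (he : 0 < e)
    (q : ℝ) :
    lpNorm Φ (ENNReal.ofReal e) (volume.restrict (cube x ρ)) ^ q =
      (∫ y in Metric.ball (WithLp.ofLp x) ρ, φ y ^ e) ^ (q / e) := by
  have hsub : cube x ρ ⊆ cube x r := fun y hy i => (hy i).trans_le hρr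
  rw [lpNorm_eq_integral_norm_rpow_toReal (by simpa using he) ENNReal.ofReal_ne_top
    (hΦ.mono_measure (Measure.restrict_mono hsub le_rfl)), ENNReal.toReal_ofReal he.le]
  have h1 : ∫ y in cube x ρ, ‖Φ y‖ ^ e = ∫ y in Metric.ball (WithLp.ofLp x) ρ, φ y ^ e := by
    rw [cube_eq_preimage x hρ] at hsub ⊢
    rw [← setIntegral_rpow_ofLp hφ hsub]
    refine integral_congr_ae ?_
    filter_upwards [ae_restrict_of_ae_restrict_of_subset hsub hφ] with y hy
    rw [hy, Real.norm_of_nonneg (hφ0 _)]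
  rw [h1, ← Real.rpow_mul (integral_nonneg fun y => Real.rpow_nonneg (hφ0 y) _),
    inv_mul_eq_div]

/-- On a set where the weight is bounded below, the weighted function controls the function. -/
theorem rpow_le_weighted {x₀ : Fin n → ℝ} {r p q c : ℝ} (hq : 0 < q) (hp : 0 < p)
    (hc : 0 < c) {φ : (Fin n → ℝ) → ℝ} (hφ0 : ∀ y, 0 ≤ φ y) {y : Fin n → ℝ}
    (hy : c ≤ weight x₀ r y) :
    φ y ^ q ≤ (1 / c) ^ (n * q / p) * (φ y * weight x₀ r y ^ ((n : ℝ) / p)) ^ q := by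
  have h1 : (1 / c) ^ (n * q / p) = ((1 / c) ^ ((n : ℝ) / p)) ^ q := by
    rw [← Real.rpow_mul (by positivity)]; congr 1; ring
  have hw := weight_nonneg (x₀ := x₀) (r := r) y
  have hφy := hφ0 y
  rw [h1, ← Real.mul_rpow (by positivity) (by positivity)]
  refine Real.rpow_le_rpow hφy ?_ hq.le
  have h2 : 1 ≤ (1 / c) ^ ((n : ℝ) / p) * weight x₀ r y ^ ((n : ℝ) / p) := by
    rw [← Real.mul_rpow (by positivity) hw]
    refine Real.one_le_rpow ?_ (by positivity)
    rw [one_div_mul_eq_div]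
    exact (one_le_div hc).2 hy
  calc φ y = φ y * 1 := (mul_one _).symm
    _ ≤ φ y * ((1 / c) ^ ((n : ℝ) / p) * weight x₀ r y ^ ((n : ℝ) / p)) := by gcongr
    _ = _ := by ring

end transfer

/-! ### Representatives and conclusion -/

/-- For each `r < R₀`, representatives on `Fin n → ℝ` of `Φ` and `Ψ` to which Gehring's lemma
applies. -/
theorem exists_representative_estimate {n : ℕ} (hn : 2 ≤ n)
    {x₀ : EuclideanSpace ℝ (Fin n)} {R₀ : ℝ} {p t α B : ℝ} (ht : 0 < t) (htp : t < p)
    (hα : 1 / 2 ≤ α) (hα1 : α < 1) (hB : 0 < B) {Φ Ψ : EuclideanSpace ℝ (Fin n) → ℝ}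
    (hΦ0 : ∀ᵐ x ∂(volume.restrict (cube x₀ R₀)), 0 ≤ Φ x)
    (hΨ0 : ∀ᵐ x ∂(volume.restrict (cube x₀ R₀)), 0 ≤ Ψ x)
    {s q : ℝ} (hs : p / t ≤ s) (hpq : p ≤ q) (hqκ : q < p + (p - t) / (kappa n s B - 1))
    (hΦ : MemLp Φ (ENNReal.ofReal p) (volume.restrict (cube x₀ R₀)))
    (hΨ : MemLp Ψ (ENNReal.ofReal q) (volume.restrict (cube x₀ R₀)))
    (hRH : ∀ z ∈ cube x₀ R₀, ∀ R : ℝ, 0 < R →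
      √(n : ℝ) * R < Metric.infDist z (frontier (cube x₀ R₀)) →
      1 / R ^ n * ∫ x in cube z (α * R), Φ x ^ p ≤
        B * (1 / R ^ n * ∫ x in cube z R, Φ x ^ t) ^ (p / t)
          + 1 / R ^ n * ∫ x in cube z R, Ψ x ^ p)
    {r : ℝ} (hr : 0 < r) (hrR : r < R₀) :
    ∃ φ ψ : (Fin n → ℝ) → ℝ, Measurable φ ∧ (∀ y, 0 ≤ φ y) ∧ (∀ y, 0 ≤ ψ y) ∧
      (∀ y ∉ Metric.ball (WithLp.ofLp x₀) r, φ y = 0) ∧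
      (∀ y ∉ Metric.ball (WithLp.ofLp x₀) r, ψ y = 0) ∧
      (∀ᵐ y ∂(volume.restrict (cube x₀ r)), Φ y = φ (WithLp.ofLp y)) ∧
      (∀ᵐ y ∂(volume.restrict (cube x₀ r)), Ψ y = ψ (WithLp.ofLp y)) ∧
      Integrable (fun x => (φ x * weight (WithLp.ofLp x₀) r x ^ ((n : ℝ) / p)) ^ q) ∧
      ∫ x, (φ x * weight (WithLp.ofLp x₀) r x ^ ((n : ℝ) / p)) ^ q ≤
      1 / (q - t - kappa n s B * (q - p)) *
        ((p - t) * r ^ (-(n * (q - p) / p)) * (2 : ℝ) ^ ((q - p) / p) *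
            (∫ x, φ x ^ p) ^ (q / p)
          + ((2 : ℝ) ^ ((n + 1) * (q - p) / p) * (p - t) + kappa n s B * (q - t)) *
            ∫ x, ψ x ^ q) := by
  have hp : 0 < p := ht.trans htp
  have hq : 0 < q := by linarith
  have hsub : cube x₀ r ⊆ cube x₀ R₀ := fun y hy i => (hy i).trans hrR
  have hmono : (volume.restrict (cube x₀ r)) ≤ volume.restrict (cube x₀ R₀) :=
    Measure.restrict_mono hsub le_rfl
  have hΦr := hΦ.mono_measure hmono
  have hΨr := hΨ.mono_measure hmono
  obtain ⟨φ, hφm, hφ0, hφs, hφ⟩ := exists_measurable_ofLp_representative hr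
    hΦr.aestronglyMeasurable (ae_restrict_of_ae_restrict_of_subset hsub hΦ0)
  obtain ⟨ψ, hψm, hψ0, hψs, hψ⟩ := exists_measurable_ofLp_representative hr
    hΨr.aestronglyMeasurable (ae_restrict_of_ae_restrict_of_subset hsub hΨ0)
  have hfin : IsFiniteMeasure ((volume : Measure (EuclideanSpace ℝ (Fin n))).restrict
      (cube x₀ r)) := by
    refine isFiniteMeasure_restrict.2 ?_
    rw [cube_eq_preimage x₀ hr, (PiLp.volume_preserving_ofLp (Fin n)).measure_preimage
      measurableSet_ball.nullMeasurableSet]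
    exact measure_ball_lt_top.ne
  have hφp := integrable_rpow_of_memLp hr hφ0 hφs hφ hp hΦr
  have hφt := integrable_rpow_of_memLp hr hφ0 hφs hφ ht
    (hΦr.mono_exponent (ENNReal.ofReal_le_ofReal htp.le))
  have hψq := integrable_rpow_of_memLp hr hψ0 hψs hψ hq hΨr
  have hψp := integrable_rpow_of_memLp hr hψ0 hψs hψ hp
    (hΨr.mono_exponent (ENNReal.ofReal_le_ofReal hpq))
  have hn1 : (1 : ℝ) ≤ n := by exact_mod_cast (by omega : 1 ≤ n)
  refine ⟨φ, ψ, hφm, hφ0, hψ0, hφs, hψs, hφ, hψ, integral_weighted_rpow_le hn hr ht htp hα hα1 hB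
    hs hpq hqκ hφm hψm hφ0 hψ0 hφp hφt hψp hψq hψs fun z hz R hR hzR => ?_⟩
  have hα0 : 0 < α := by linarith
  have hzc : WithLp.toLp 2 z ∈ cube x₀ r := by
    rw [cube_eq_preimage x₀ hr]; exact hz
  have hRz : R < r - dist z (WithLp.ofLp x₀) :=
    (le_mul_of_one_le_left hR.le (Real.one_le_sqrt.2 hn1)).trans_lt hzR
  have hballs : ∀ ρ, ρ ≤ R → (WithLp.ofLp : EuclideanSpace ℝ (Fin n) → Fin n → ℝ) ⁻¹'
      Metric.ball z ρ ⊆ cube x₀ r := fun ρ hρ => by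
    rw [cube_eq_preimage x₀ hr]
    exact Set.preimage_mono (Metric.ball_subset_ball' (by linarith))
  -- The distance from `z` to the frontier of the larger cube is at least `R₀ - dist z x₀`, which
  -- exceeds `r - dist z x₀`.
  have h := hRH (WithLp.toLp 2 z) (hsub hzc) R hR (by
    have := dist_ofLp_le_infDist_frontier (by omega) x₀ (WithLp.toLp 2 z) (hr.trans hrR)
    rw [WithLp.ofLp_toLp] at this
    linarith)
  rw [cube_eq_preimage _ hR, cube_eq_preimage _ (by positivity : 0 < α * R), WithLp.ofLp_toLp,
    setIntegral_rpow_ofLp hφ (hballs _ (mul_le_of_le_one_left hR.le hα1.le)),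
    setIntegral_rpow_ofLp hφ (hballs _ le_rfl), setIntegral_rpow_ofLp hψ (hballs _ le_rfl)] at h
  exact h

end ReverseHolder

theorem corollary3p1 (n : ℕ) (hn : 2 ≤ n)
    (Ω : Set (EuclideanSpace ℝ (Fin n))) (hΩ : IsOpen Ω) (hΩb : Bornology.IsBounded Ω)
    (x₀ : EuclideanSpace ℝ (Fin n)) (hx₀ : x₀ ∈ Ω) (R₀ : ℝ) (hR₀ : 0 < R₀)
    (hdist : √(n : ℝ) * R₀ < Metric.infDist x₀ (frontier Ω))
    (p δ t α B : ℝ) (hp : 1 < p) (hδ : 0 < δ) (ht : 0 < t) (htp : t < p)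
    (hα : 1 / 2 ≤ α) (hα1 : α < 1) (hB : 0 < B)
    (Φ Ψ : EuclideanSpace ℝ (Fin n) → ℝ)
    (hΦ0 : ∀ᵐ x ∂(volume.restrict Ω), 0 ≤ Φ x) (hΨ0 : ∀ᵐ x ∂(volume.restrict Ω), 0 ≤ Ψ x)
    (hΦ : MemLp Φ (ENNReal.ofReal p) (volume.restrict Ω))
    (hΨ : MemLp Ψ (ENNReal.ofReal (p + δ)) (volume.restrict Ω))
    (hRH : ∀ z ∈ ReverseHolder.cube x₀ R₀, ∀ R : ℝ, 0 < R →
      √(n : ℝ) * R < Metric.infDist z (frontier (ReverseHolder.cube x₀ R₀)) →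
      1 / R ^ n * ∫ x in ReverseHolder.cube z (α * R), Φ x ^ p ≤
        B * (1 / R ^ n * ∫ x in ReverseHolder.cube z R, Φ x ^ t) ^ (p / t)
          + 1 / R ^ n * ∫ x in ReverseHolder.cube z R, Ψ x ^ p)
    (s : ℝ) (hs : p / t ≤ s)
    (q : ℝ) (hpq : p ≤ q) (hqδ : q ≤ p + δ)
    (hqκ : q < p + (p - t) / (ReverseHolder.kappa n s B - 1)) :
    ReverseHolder.MemLpLocOn Φ q (ReverseHolder.cube x₀ R₀) ∧
    ∀ r : ℝ, 0 < r → r < R₀ →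
      lpNorm Φ (ENNReal.ofReal q) (volume.restrict (ReverseHolder.cube x₀ (r / 2))) ^ q ≤
        (2 : ℝ) ^ (n * q / p) / (q - t - ReverseHolder.kappa n s B * (q - p)) *
          ((p - t) * r ^ (-(n * (q - p) / p)) * (2 : ℝ) ^ ((q - p) / p) *
              lpNorm Φ (ENNReal.ofReal p) (volume.restrict (ReverseHolder.cube x₀ r)) ^ q
            + ((2 : ℝ) ^ ((n + 1) * (q - p) / p) * (p - t)
                + ReverseHolder.kappa n s B * (q - t)) *
              lpNorm Ψ (ENNReal.ofReal q) (volume.restrict (ReverseHolder.cube x₀ r)) ^ q) := by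
  have hp0 : 0 < p := by linarith
  have hq0 : 0 < q := by linarith
  have hsub : ReverseHolder.cube x₀ R₀ ⊆ Ω :=
    ReverseHolder.cube_subset_of_lt_infDist (by omega) hx₀ hR₀ hdist
  have hfin : IsFiniteMeasure ((volume : Measure (EuclideanSpace ℝ (Fin n))).restrict Ω) :=
    isFiniteMeasure_restrict.2 hΩb.measure_lt_top.ne
  have hmono := Measure.restrict_mono hsub (le_refl (volume : Measure (EuclideanSpace ℝ (Fin n))))
  have hΦ' := hΦ.mono_measure hmono
  have hΨ' := (hΨ.mono_exponent (ENNReal.ofReal_le_ofReal hqδ)).mono_measure hmono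
  have key : ∀ {r : ℝ}, 0 < r → r < R₀ → _ := fun {r} hr hrR =>
    ReverseHolder.exists_representative_estimate hn ht htp hα hα1 hB
      (ae_restrict_of_ae_restrict_of_subset hsub hΦ0)
      (ae_restrict_of_ae_restrict_of_subset hsub hΨ0) hs hpq hqκ hΦ' hΨ' hRH hr hrR
  have hcr : ∀ {r : ℝ}, r < R₀ → ReverseHolder.cube x₀ r ⊆ ReverseHolder.cube x₀ R₀ :=
    fun hrR y hy i => (hy i).trans hrR
  refine ⟨fun K hK hKQ => ?_, fun r hr hrR => ?_⟩
  · obtain ⟨c, hc0, hcR, hKc⟩ : ∃ c : ℝ, 0 ≤ c ∧ c < R₀ ∧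
        ∀ y ∈ K, dist (WithLp.ofLp y) (WithLp.ofLp x₀) ≤ c := by
      rcases K.eq_empty_or_nonempty with h | h
      · exact ⟨0, le_rfl, hR₀, by simp [h]⟩
      · obtain ⟨y, hy, hmax⟩ := hK.exists_isMaxOn h
          (f := fun y => dist (WithLp.ofLp y) (WithLp.ofLp x₀))
          ((PiLp.continuous_ofLp 2 _).dist continuous_const).continuousOn
        have := hKQ hy
        rw [ReverseHolder.cube_eq_preimage x₀ hR₀] at this
        exact ⟨_, dist_nonneg, this, fun z hz => hmax hz⟩
    -- Any radius strictly between `c` and `R₀` serves: on `K` the weight is then at least `1 - c /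
    -- r > 0`.
    set r := (c + R₀) / 2 with hrdef
    have hcr' : c < r := by rw [hrdef]; linarith
    have hr : 0 < r := by linarith
    have hrR : r < R₀ := by rw [hrdef]; linarith
    obtain ⟨φ, ψ, hφm, hφ0, -, -, -, hφ, -, hint, -⟩ := key hr hrR
    have hKr : K ⊆ ReverseHolder.cube x₀ r := fun y hy => by
      rw [ReverseHolder.cube_eq_preimage x₀ hr]
      exact (hKc y hy).trans_lt hcr'
    have hΦK : AEStronglyMeasurable Φ (volume.restrict K) :=
      hΦ'.aestronglyMeasurable.mono_measure
        (Measure.restrict_mono (hKr.trans (hcr hrR)) le_rfl)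
    refine (integrable_norm_rpow_iff hΦK (by simpa using hq0) ENNReal.ofReal_ne_top).1 ?_
    rw [ENNReal.toReal_ofReal hq0.le]
    have hint' := ((PiLp.volume_preserving_ofLp (Fin n)).integrable_comp_emb
      ReverseHolder.measurableEmbedding_ofLp).2 hint
    have hc' : 0 < 1 - c / r := by
      have := (div_lt_one hr).2 hcr'
      linarith
    refine ((hint'.const_mul ((1 / (1 - c / r)) ^ (n * q / p))).restrict (s := K)).mono'
      (hΦK.norm.aemeasurable.pow_const q).aestronglyMeasurable ?_
    filter_upwards [ae_restrict_mem hK.measurableSet,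
      ae_restrict_of_ae_restrict_of_subset hKr hφ] with y hy hy'
    rw [hy', Real.norm_of_nonneg (hφ0 _), Real.norm_of_nonneg (Real.rpow_nonneg (hφ0 _) _)]
    refine ReverseHolder.rpow_le_weighted hq0 hp0 hc' hφ0 ?_
    refine le_max_of_le_right ?_
    have := div_le_div_of_nonneg_right (hKc y hy) hr.le
    linarith
  · obtain ⟨φ, ψ, hφm, hφ0, hψ0, hφs, hψs, hφ, hψ, hint, hest⟩ := key hr hrR
    have hmr := Measure.restrict_mono (hcr hrR)
      (le_refl (volume : Measure (EuclideanSpace ℝ (Fin n))))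
    have hΦr := hΦ'.aestronglyMeasurable.mono_measure hmr
    have hΨr := hΨ'.aestronglyMeasurable.mono_measure hmr
    rw [ReverseHolder.lpNorm_rpow_eq_setIntegral (half_pos hr) (by linarith) hφ0 hΦr hφ hq0,
      ReverseHolder.lpNorm_rpow_eq_setIntegral hr le_rfl hφ0 hΦr hφ hp0,
      ReverseHolder.lpNorm_rpow_eq_setIntegral hr le_rfl hψ0 hΨr hψ hq0, div_self hq0.ne',
      Real.rpow_one, Real.rpow_one,
      setIntegral_eq_integral_of_forall_compl_eq_zero (f := fun y => φ y ^ p) fun x hx => by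
        rw [hφs x hx, Real.zero_rpow hp0.ne'],
      setIntegral_eq_integral_of_forall_compl_eq_zero (f := fun y => ψ y ^ q) fun x hx => by
        rw [hψs x hx, Real.zero_rpow hq0.ne']]
    have hhalf : ∀ y ∈ Metric.ball (WithLp.ofLp x₀) (r / 2), φ y ^ q ≤
        (2 : ℝ) ^ (n * q / p) *
          (φ y * ReverseHolder.weight (WithLp.ofLp x₀) r y ^ ((n : ℝ) / p)) ^ q := fun y hy => by
      have h1 : (1 : ℝ) / 2 ≤ ReverseHolder.weight (WithLp.ofLp x₀) r y := by
        refine le_max_of_le_right ?_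
        have := div_le_div_of_nonneg_right (Metric.mem_ball.1 hy).le hr.le
        have h2 : r / 2 / r = 1 / 2 := by field_simp
        linarith
      simpa using ReverseHolder.rpow_le_weighted hq0 hp0 one_half_pos hφ0 h1
    have hnn : ∀ y, 0 ≤ (2 : ℝ) ^ (n * q / p) *
        (φ y * ReverseHolder.weight (WithLp.ofLp x₀) r y ^ ((n : ℝ) / p)) ^ q := fun y =>
      mul_nonneg (by positivity) (Real.rpow_nonneg (mul_nonneg (hφ0 y)
        (Real.rpow_nonneg (ReverseHolder.weight_nonneg y) _)) _)
    have hint2 := hint.const_mul ((2 : ℝ) ^ (n * q / p))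
    have hφq : IntegrableOn (fun y => φ y ^ q) (Metric.ball (WithLp.ofLp x₀) (r / 2)) := by
      refine hint2.integrableOn.mono' (hφm.pow_const q).aestronglyMeasurable ?_
      filter_upwards [ae_restrict_mem measurableSet_ball] with y hy
      rw [Real.norm_of_nonneg (Real.rpow_nonneg (hφ0 y) _)]
      exact hhalf y hy
    calc ∫ y in Metric.ball (WithLp.ofLp x₀) (r / 2), φ y ^ q
        ≤ ∫ y in Metric.ball (WithLp.ofLp x₀) (r / 2), (2 : ℝ) ^ (n * q / p) *
          (φ y * ReverseHolder.weight (WithLp.ofLp x₀) r y ^ ((n : ℝ) / p)) ^ q :=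
          setIntegral_mono_on hφq hint2.integrableOn measurableSet_ball hhalf
      _ ≤ ∫ y, (2 : ℝ) ^ (n * q / p) *
          (φ y * ReverseHolder.weight (WithLp.ofLp x₀) r y ^ ((n : ℝ) / p)) ^ q :=
          setIntegral_le_integral hint2 (Filter.Eventually.of_forall hnn)
      _ = (2 : ℝ) ^ (n * q / p) *
          ∫ y, (φ y * ReverseHolder.weight (WithLp.ofLp x₀) r y ^ ((n : ℝ) / p)) ^ q :=
          integral_const_mul _ _
      _ ≤ _ := mul_le_mul_of_nonneg_left hest (by positivity)
      _ = _ := by rw [← mul_assoc, mul_one_div]
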